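/- **Corollary (Better phase estimation).** Notation. For an integer $m\ge 0$ let $\mathrm{PE}_m(G)$ denote phase estimation with an $m$-qubit register, in which every use of the controlled unitary is carried out by an operation $G$ acting on one register qubit and the target system $\mathbb{C}^D$: prepare the register in $|0\dots0\rangle$, apply a Hadamard gate to each register qubit, apply $G$ to register qubit $j$ and the target $2^j$ times for each $j=0,\dots,m-1$ ($2^m-1$ uses in total), apply the inverse quantum Fourier transform modulo $2^m$ to the register, and measure the register in the computational basis. The outcome $y\in\{0,\dots,2^m-1\}$ is kept as a classical register next to the target, and the reported phase is the representative $\hat\theta\in(-\pi,\pi]$ of $2\pi y/2^m$ modulo $2\pi$. Kitaev's phase estimation on a unitary $U$ is $\mathrm{PE}_m$ with exact controlled gates $|0\rangle\langle0|\otimes\mathbb{1}+|1\rangle\langle1|\otimes U$. Claim. For every $\eta\in(0,1)$ there is a constant $C>0$, depending only on $\eta$, such that for every $\varepsilon>0$ there are integers $m,r\ge 0$ with $$(2^m-1)\,r\;\le\;\frac{C}{\varepsilon^2}$$ for which the following holds. For every dimension $D$ there is a quantum channel (completely positive trace-preserving map) $G$, independent of $\rho$, taking a qubit, the target system $\mathbb{C}^D$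 and $r$ further systems $\mathbb{C}^D$ to a qubit and the target system, such that for every density matrix $\rho$ on $\mathbb{C}^D$, with $U=e^{-i\rho}$ and $G_\rho(X)=G(X\otimes\rho^{\otimes r})$ (each use of $G_\rho$ consumes $r$ fresh copies of $\rho$, so that $\mathrm{PE}_m(G_\rho)$ consumes $(2^m-1)r$ copies in total): 1. $\mathrm{PE}_m(G_\rho)$ performs Kitaev's phase estimation on $U$ with $m$ register qubits up to error $\eta$ in diamond norm distance: for every finite-dimensional reference system and every joint input state of the target and the reference system, the outputs of the two procedures have trace distance at most $\eta$. 2. $\mathrm{PE}_m(G_\rho)$ has precision $\varepsilon$ with failure probability at most $\eta$: for every unit eigenvector $v$ of $U$, $Uv=e^{i\theta}v$ with $\theta\in(-\pi,\pi]$, on input $|v\rangle\langle v|$ the reported phase satisfies $|\hat\theta-\theta|\le\varepsilon$ with probability at least $1-\eta$. In particular, for constant $\eta$, Kitaev's phase estimation on $U=e^{-i\rho}$ can be performed to precision $\varepsilon$ with constant failure probability using $O(1/\varepsilon^2)$ copies of $\rho$, with no dependence on the dimension. -/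

import Mathlib

open scoped Matrix Kronecker ComplexOrder

noncomputable section

namespace SamplePhaseEstimation

/-- Linear maps taking operators on `ℂ^a` to operators on `ℂ^b`. -/
abbrev SuperOp (a b : Type*) : Type _ := Matrix a a ℂ →ₗ[ℂ] Matrix b b ℂ

/-- A quantum state (density matrix): positive semidefinite with trace one. -/
def IsDensity {a : Type*} [Fintype a] (ρ : Matrix a a ℂ) : Prop :=
  ρ.PosSemidef ∧ ρ.trace = 1

/-- The trace norm `‖A‖₁ = Tr √(A A†)`, as the sum of the square roots of the eigenvalues of
`A A†`. -/
def traceNorm {a : Type*} [Fintype a] [DecidableEq a] (A : Matrix a a ℂ) : ℝ :=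
  ∑ i, Real.sqrt ((Matrix.isHermitian_mul_conjTranspose_self A).eigenvalues i)

/-- `Φ ⊗ id` on a bipartite system whose second factor is an arbitrary reference system `k`. -/
def withReference {a b : Type*} (k : Type*) (Φ : SuperOp a b) : SuperOp (a × k) (b × k) where
  toFun X := Matrix.of fun p q => Φ (Matrix.of fun c c' => X (c, p.2) (c', q.2)) p.1 q.1
  map_add' X Y := by
    ext p q
    exact congrFun (congrFun (map_add Φ (Matrix.of fun c c' => X (c, p.2) (c', q.2))
      (Matrix.of fun c c' => Y (c, p.2) (c', q.2))) p.1) q.1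
  map_smul' s X := by
    ext p q
    exact congrFun (congrFun (map_smul Φ s (Matrix.of fun c c' => X (c, p.2) (c', q.2))) p.1) q.1

/-- A quantum channel: a completely positive trace-preserving linear map. -/
def IsChannel {a b : Type*} [Fintype a] [Fintype b] (Φ : SuperOp a b) : Prop :=
  (∀ (k : ℕ) (X : Matrix (a × Fin k) (a × Fin k) ℂ),
      X.PosSemidef → (withReference (Fin k) Φ X).PosSemidef) ∧
    ∀ X : Matrix a a ℂ, (Φ X).trace = X.trace

/-- `½ ‖Φ - Ψ‖_⋄ ≤ δ`: on every state of the system and of a reference system of any finite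
dimension, the two outputs have trace distance at most `δ`. -/
def DiamondDistLE {a b : Type*} [Fintype a] [Fintype b] [DecidableEq b]
    (Φ Ψ : SuperOp a b) (δ : ℝ) : Prop :=
  ∀ (k : ℕ) (σ : Matrix (a × Fin k) (a × Fin k) ℂ), IsDensity σ →
    (1 / 2 : ℝ) * traceNorm (withReference (Fin k) Φ σ - withReference (Fin k) Ψ σ) ≤ δ

/-- `X ↦ W X W†`. -/
def conjBy {a b : Type*} [Fintype a] (W : Matrix b a ℂ) : SuperOp a b where
  toFun X := W * X * Wᴴ
  map_add' X Y := by rw [Matrix.mul_add, Matrix.add_mul]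
  map_smul' s X := by simp

/-- The tensor power `M^{⊗ n}`. -/
def tensorPower {a : Type*} (M : Matrix a a ℂ) (n : ℕ) : Matrix (Fin n → a) (Fin n → a) ℂ :=
  Matrix.of fun f g => ∏ i, M (f i) (g i)

/-- An operation that takes a system `a` together with `r` systems `d`, run with the `r` extra
systems prepared as `r` copies of `ρ`: the map `X ↦ G (X ⊗ ρ^{⊗ r})`. -/
def withCopies {a b d : Type*} (r : ℕ) (G : SuperOp (a × (Fin r → d)) b) (ρ : Matrix d d ℂ) :
    SuperOp a b where
  toFun X := G (X ⊗ₖ tensorPower ρ r)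
  map_add' X Y := by rw [Matrix.add_kronecker, map_add]
  map_smul' s X := by rw [Matrix.smul_kronecker, map_smul, RingHom.id_apply]

/-- Computational basis states of an `m`-qubit register. -/
abbrev Reg (m : ℕ) : Type := Fin m → Fin 2

/-- The integer `∑ⱼ xⱼ 2ʲ` with binary digits `x`. -/
def regVal {m : ℕ} (x : Reg m) : ℕ := ∑ j, (x j : ℕ) * 2 ^ (j : ℕ)

/-- The one-qubit Hadamard gate. -/
def hadamard : Matrix (Fin 2) (Fin 2) ℂ :=
  (((Real.sqrt 2)⁻¹ : ℝ) : ℂ) • !![1, 1; 1, -1]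

/-- The quantum Fourier transform modulo `2^m`. -/
def qft (m : ℕ) : Matrix (Reg m) (Reg m) ℂ :=
  Matrix.of fun y x => (((Real.sqrt (2 ^ m))⁻¹ : ℝ) : ℂ) *
    Complex.exp (2 * Real.pi * Complex.I * (regVal x * regVal y : ℕ) / 2 ^ m)

/-- The controlled gate `|0⟩⟨0| ⊗ 1 + |1⟩⟨1| ⊗ U`. -/
def controlled {d : Type*} [DecidableEq d] (U : Matrix d d ℂ) :
    Matrix (Fin 2 × d) (Fin 2 × d) ℂ :=
  Matrix.single 0 0 1 ⊗ₖ (1 : Matrix d d ℂ) + Matrix.single 1 1 1 ⊗ₖ U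

/-- The operation `G` on one qubit and the target, applied to qubit `j` of the register and the
target, tensored with the identity on the other qubits of the register. -/
def onQubit {m : ℕ} {d : Type*} (j : Fin m) (G : SuperOp (Fin 2 × d) (Fin 2 × d)) :
    SuperOp (Reg m × d) (Reg m × d) where
  toFun X := Matrix.of fun p q =>
    G (Matrix.of fun c c' =>
      X (Function.update p.1 j c.1, c.2) (Function.update q.1 j c'.1, c'.2))
      (p.1 j, p.2) (q.1 j, q.2)
  map_add' X Y := by
    ext p q
    exact congrFun (congrFun (map_add G
      (Matrix.of fun c c' =>
        X (Function.update p.1 j c.1, c.2) (Function.update q.1 j c'.1, c'.2))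
      (Matrix.of fun c c' =>
        Y (Function.update p.1 j c.1, c.2) (Function.update q.1 j c'.1, c'.2)))
      (p.1 j, p.2)) (q.1 j, q.2)
  map_smul' s X := by
    ext p q
    exact congrFun (congrFun (map_smul G s
      (Matrix.of fun c c' =>
        X (Function.update p.1 j c.1, c.2) (Function.update q.1 j c'.1, c'.2)))
      (p.1 j, p.2)) (q.1 j, q.2)

/-- The control qubits of the successive uses of the controlled unitary in phase estimation with
`m` register qubits: qubit `j` controls `2ʲ` uses, that is, a controlled-`U^(2ʲ)`. -/
def controlSchedule (m : ℕ) : List (Fin m) :=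
  (List.finRange m).flatMap fun j : Fin m => List.replicate (2 ^ j.val) j

/-- Preparation of the register in the state `|0…0⟩` next to the target. -/
def initRegister (m : ℕ) (d : Type*) : SuperOp d (Reg m × d) where
  toFun X := Matrix.single (0 : Reg m) (0 : Reg m) (1 : ℂ) ⊗ₖ X
  map_add' X Y := by rw [Matrix.kronecker_add]
  map_smul' s X := by rw [Matrix.kronecker_smul, RingHom.id_apply]

/-- Measurement of the register in the computational basis, the outcome being kept as a classical
(diagonal) register. -/
def measureRegister (m : ℕ) (d : Type*) : SuperOp (Reg m × d) (Reg m × d) where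
  toFun X := Matrix.of fun p q => if p.1 = q.1 then X p q else 0
  map_add' X Y := by ext p q; by_cases h : p.1 = q.1 <;> simp [h]
  map_smul' s X := by ext p q; by_cases h : p.1 = q.1 <;> simp [h]

/-- The phase estimation circuit with `m` register qubits, in which every use of the controlled
unitary is performed by the operation `G` on one register qubit and the target: prepare `|0…0⟩`,
apply `H^{⊗ m}`, apply `G` according to the schedule (products of endomorphisms are compositions),
apply the inverse quantum Fourier transform, and measure the register. -/
def phaseEstimation (m : ℕ) {d : Type*} [Fintype d] [DecidableEq d]
    (G : SuperOp (Fin 2 × d) (Fin 2 × d)) : SuperOp d (Reg m × d) :=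
  measureRegister m d ∘ₗ
    conjBy ((qft m)ᴴ ⊗ₖ (1 : Matrix d d ℂ)) ∘ₗ
    ((controlSchedule m).map fun j =>
      (onQubit j G : Module.End ℂ (Matrix (Reg m × d) (Reg m × d) ℂ))).prod ∘ₗ
    conjBy (tensorPower hadamard m ⊗ₖ (1 : Matrix d d ℂ)) ∘ₗ
    initRegister m d

/-- Kitaev's phase estimation on the unitary `U`, with exact controlled-`U` gates. -/
def kitaev (m : ℕ) {d : Type*} [Fintype d] [DecidableEq d] (U : Matrix d d ℂ) :
    SuperOp d (Reg m × d) :=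
  phaseEstimation m (conjBy (controlled U))

/-- The number of copies of `ρ` consumed by phase estimation with `m` register qubits when each
use of the controlled unitary consumes `r` fresh copies. -/
def samplesUsed (m r : ℕ) : ℕ := (controlSchedule m).length * r

/-- The probability of the outcome `x` in the register of the state `τ`. -/
def outcomeProb {m : ℕ} {d : Type*} [Fintype d] (τ : Matrix (Reg m × d) (Reg m × d) ℂ)
    (x : Reg m) : ℝ :=
  ∑ a, (τ (x, a) (x, a)).re

/-- The phase in `(-π, π]` reported on outcome `x`: the representative of `2π x / 2^m`. -/
def phaseEstimate {m : ℕ} (x : Reg m) : ℝ :=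
  toIocMod Real.two_pi_pos (-Real.pi) (2 * Real.pi * regVal x / 2 ^ m)

end SamplePhaseEstimation

end

open SamplePhaseEstimation

noncomputable section

namespace SamplePhaseEstimation
open Matrix

/-! The channel is density matrix exponentiation: `r` times, with angle `t = 1 / r`, a controlled
partial swap `exp(-i t SWAP)` is applied to the qubit, the target and a fresh copy of `ρ`, and the
copy is discarded. Tracing out the copy turns the swap into multiplication by `ρ`, so one step
agrees with conjugation by the gate that is `1` on control `0` and `cos t - i ρ sin t` on control
`1`, up to two completely positive terms of weight `sin² t` (`lmrStep_kronecker`). Over `r` steps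
this costs at most `2 / r`. The `r`-th power of that gate is compared with the controlled `exp(-i
ρ)` eigenvalue by eigenvalue, which costs another `2 / r` (`close_withCopies_lmr`). Only positivity
and unit trace of `ρ` enter, so no dimension appears.

Errors are measured by `Close`: a difference of maps is written as a difference of completely
positive maps with controlled total trace. This adds up along circuits, survives references, and
bounds both the trace distance and outcome probabilities. The `2^m - 1` uses of the gate thus cost
`4 (2^m - 1) / r`, which is small once `r` is of order `2^m / η`.

For exact phase estimation, phase kickback gives outcome `k` the probability `|2^{-m} ∑ z^n|²`, with
`z = exp(i (θ - 2πk/2^m))`. Far outcomes are bounded by averaging: if `|1 - z| ≥ τ` and `N τ ≥ 4`,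
then `|1 - z|⁻²` is at most the mean of the squared geometric sums of lengths below `N`. Parseval
sums these over all outcomes, giving a tail of at most `4 N / 2^m` (`sum_outcome_tail_le`). With `N`
of order `1 / ε` it suffices that `2^m` is of order `1 / (ε η)`, and the number of copies is of
order `4^m / η`, hence `1 / (η³ ε²)`. -/

/-- Complete positivity, with respect to reference systems indexed by any finite type. -/
def IsCP {a b : Type} [Fintype a] [Fintype b] (Φ : SuperOp a b) : Prop :=
  ∀ (K : Type) [Fintype K] (X : Matrix (a × K) (a × K) ℂ),
    X.PosSemidef → (withReference K Φ X).PosSemidef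

/-- On positive operators, `Φ` increases the trace by at most the factor `c`. -/
def TraceLE {a b : Type} [Fintype a] [Fintype b] (Φ : SuperOp a b) (c : ℝ) : Prop :=
  ∀ X : Matrix a a ℂ, X.PosSemidef → (Φ X).trace.re ≤ c * X.trace.re

/-- `Φ` preserves the trace. -/
def IsTP {a b : Type} [Fintype a] [Fintype b] (Φ : SuperOp a b) : Prop :=
  ∀ X : Matrix a a ℂ, (Φ X).trace = X.trace

lemma trace_re_nonneg {a : Type} [Fintype a] {X : Matrix a a ℂ} (hX : X.PosSemidef) :
    0 ≤ X.trace.re :=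
  (Complex.nonneg_iff.mp hX.trace_nonneg).1

lemma withReference_apply {a b : Type} (K : Type) (Φ : SuperOp a b)
    (X : Matrix (a × K) (a × K) ℂ) (p q : b × K) :
    withReference K Φ X p q = Φ (X.submatrix (fun c => (c, p.2)) fun c => (c, q.2)) p.1 q.1 := rfl

lemma trace_withReference {a b : Type} [Fintype b] (K : Type) [Fintype K] (Φ : SuperOp a b)
    (X : Matrix (a × K) (a × K) ℂ) :
    (withReference K Φ X).trace
      = ∑ k, (Φ (X.submatrix (fun i => (i, k)) fun i => (i, k))).trace := by
  simp only [trace, diag_apply, Fintype.sum_prod_type, withReference_apply]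
  exact Finset.sum_comm

/-! ### Completely positive maps -/

section CP
variable {a b c : Type} [Fintype a] [Fintype b] [Fintype c]

lemma IsCP.posSemidef {Φ : SuperOp a b} (h : IsCP Φ) {X : Matrix a a ℂ} (hX : X.PosSemidef) :
    (Φ X).PosSemidef :=
  (h Unit _ (hX.submatrix Prod.fst)).submatrix fun i => (i, ())

lemma IsCP.comp {Φ : SuperOp b c} {Ψ : SuperOp a b} (hΦ : IsCP Φ) (hΨ : IsCP Ψ) :
    IsCP (Φ ∘ₗ Ψ) :=
  fun K _ _ hX => hΦ K _ (hΨ K _ hX)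

lemma IsCP.id : IsCP (LinearMap.id : SuperOp a a) := fun _ _ _ hX => hX

lemma IsCP.add {Φ Ψ : SuperOp a b} (hΦ : IsCP Φ) (hΨ : IsCP Ψ) : IsCP (Φ + Ψ) :=
  fun K _ _ hX => (hΦ K _ hX).add (hΨ K _ hX)

lemma IsCP.zero : IsCP (0 : SuperOp a b) := fun _ _ _ _ => PosSemidef.zero

lemma IsCP.sum {ι : Type} (s : Finset ι) {Φ : ι → SuperOp a b} (h : ∀ i ∈ s, IsCP (Φ i)) :
    IsCP (∑ i ∈ s, Φ i) := by
  classical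
  induction s using Finset.induction_on with
  | empty => simpa using IsCP.zero
  | insert i s hi ih =>
    rw [Finset.sum_insert hi]
    exact (h i (by simp)).add (ih fun j hj => h j (by simp [hj]))

lemma IsCP.smul {Φ : SuperOp a b} (hΦ : IsCP Φ) {x : ℝ} (hx : 0 ≤ x) : IsCP ((x : ℂ) • Φ) :=
  fun K _ _ hX => (hΦ K _ hX).smul (a := (x : ℂ)) (by exact_mod_cast hx)

/-- Two successive references `K` and `K'` form the single reference `K × K'`; letting `IsCP` range
over all finite types avoids any reindexing by `Fin k`. -/
lemma IsCP.withReference {Φ : SuperOp a b} (hΦ : IsCP Φ) (K : Type) [Fintype K] :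
    IsCP (withReference K Φ) :=
  fun K' _ _ hX => (hΦ (K × K') _ (hX.submatrix (Equiv.prodAssoc a K K').symm)).submatrix
    (Equiv.prodAssoc b K K')

/-- Relabelling of basis states. -/
def relabel (f : b → a) : SuperOp a b where
  toFun X := X.submatrix f f
  map_add' _ _ := rfl
  map_smul' _ _ := rfl

lemma IsCP.relabel (f : b → a) : IsCP (relabel f) :=
  fun K _ _ hX => hX.submatrix (Prod.map f (_root_.id : K → K))

lemma IsTP.relabel (e : b ≃ a) : IsTP (SamplePhaseEstimation.relabel e) :=
  fun X => e.sum_comp fun i => X i i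

lemma IsCP.conjBy (W : Matrix b a ℂ) : IsCP (conjBy W) := by
  classical
  intro K _ X hX
  have : SamplePhaseEstimation.withReference K (SamplePhaseEstimation.conjBy W) X
      = (W ⊗ₖ (1 : Matrix K K ℂ)) * X * (W ⊗ₖ (1 : Matrix K K ℂ))ᴴ := by
    ext p q
    simp [withReference_apply, SamplePhaseEstimation.conjBy, mul_apply, Fintype.sum_prod_type,
      one_apply, apply_ite]
  rw [this]
  exact hX.mul_mul_conjTranspose_same _

/-- Appending a system in the state `ρ`. -/
def appendState (ρ : Matrix c c ℂ) : SuperOp a (a × c) where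
  toFun X := X ⊗ₖ ρ
  map_add' X Y := by rw [Matrix.add_kronecker]
  map_smul' s X := by rw [Matrix.smul_kronecker, RingHom.id_apply]

lemma IsCP.appendState {ρ : Matrix c c ℂ} (hρ : ρ.PosSemidef) :
    IsCP (appendState ρ : SuperOp a (a × c)) := by
  classical
  intro K _ X hX
  exact (hX.kronecker hρ).submatrix fun p : (a × c) × K => ((p.1.1, p.2), p.1.2)

lemma IsTP.appendState {ρ : Matrix c c ℂ} (hρ : ρ.trace = 1) :
    IsTP (SamplePhaseEstimation.appendState ρ : SuperOp a (a × c)) :=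
  fun X => by simp [SamplePhaseEstimation.appendState, trace_kronecker, hρ]

/-- The partial trace over the second system. -/
def partialTrace : SuperOp (a × c) a where
  toFun X := ∑ i, X.submatrix (fun j => (j, i)) fun j => (j, i)
  map_add' X Y := by rw [← Finset.sum_add_distrib]; rfl
  map_smul' s X := by rw [RingHom.id_apply, Finset.smul_sum]; rfl

lemma IsCP.partialTrace : IsCP (partialTrace : SuperOp (a × c) a) := by
  intro K _ X hX
  have : SamplePhaseEstimation.withReference K (SamplePhaseEstimation.partialTrace) X
      = ∑ i : c, X.submatrix (fun p : a × K => ((p.1, i), p.2)) fun p => ((p.1, i), p.2) := by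
    ext p q
    simp [withReference_apply, SamplePhaseEstimation.partialTrace, Matrix.sum_apply]
  rw [this]
  exact posSemidef_sum _ fun i _ => hX.submatrix _

lemma IsTP.partialTrace : IsTP (SamplePhaseEstimation.partialTrace : SuperOp (a × c) a) := by
  intro X
  simp [SamplePhaseEstimation.partialTrace, trace, Matrix.sum_apply, Fintype.sum_prod_type]

end CP

/-! ### Bounds on the trace of the output -/

section trace
variable {a b c : Type} [Fintype a] [Fintype b] [Fintype c]

lemma IsTP.comp {Φ : SuperOp b c} {Ψ : SuperOp a b} (hΦ : IsTP Φ) (hΨ : IsTP Ψ) :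
    IsTP (Φ ∘ₗ Ψ) :=
  fun X => (hΦ _).trans (hΨ X)

lemma IsTP.withReference {Φ : SuperOp a b} (h : IsTP Φ) (K : Type) [Fintype K] :
    IsTP (withReference K Φ) := by
  intro X
  simp only [trace_withReference, h _]
  simp only [trace, diag_apply, Fintype.sum_prod_type, submatrix_apply]
  exact Finset.sum_comm

/-- The trace is the sum over the diagonal blocks indexed by the reference, and each such block of a
positive operator is positive. -/
lemma TraceLE.withReference {Φ : SuperOp a b} {x : ℝ} (h : TraceLE Φ x) (K : Type) [Fintype K] :
    TraceLE (withReference K Φ) x := by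
  intro X hX
  have hX' : X.trace = ∑ k, (X.submatrix (fun i => (i, k)) fun i => (i, k)).trace := by
    simp only [trace, diag_apply, Fintype.sum_prod_type, submatrix_apply]
    exact Finset.sum_comm
  rw [trace_withReference, hX', Complex.re_sum, Complex.re_sum, Finset.mul_sum]
  exact Finset.sum_le_sum fun k _ => h _ (hX.submatrix _)

lemma IsTP.traceLE {Φ : SuperOp a b} (h : IsTP Φ) : TraceLE Φ 1 :=
  fun X _ => by rw [h X, one_mul]

lemma TraceLE.comp {Φ : SuperOp b c} {Ψ : SuperOp a b} {x y : ℝ} (hΦ : TraceLE Φ x)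
    (hx : 0 ≤ x) (hΨ : TraceLE Ψ y) (hΨ' : IsCP Ψ) : TraceLE (Φ ∘ₗ Ψ) (x * y) := by
  intro X hX
  calc _ ≤ x * (Ψ X).trace.re := hΦ _ (hΨ'.posSemidef hX)
    _ ≤ x * (y * X.trace.re) := by gcongr; exact hΨ X hX
    _ = _ := by ring

lemma IsTP.conjBy [DecidableEq a] {W : Matrix b a ℂ} (h : Wᴴ * W = 1) : IsTP (conjBy W) := by
  intro X
  change (W * X * Wᴴ).trace = _
  rw [trace_mul_comm, ← Matrix.mul_assoc, h, Matrix.one_mul]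

/-- With `X = B B†`, the slack `x Tr X - Tr W X W†` is the trace of the positive operator `B† (x -
W† W) B`. -/
lemma TraceLE.conjBy [DecidableEq a] {W : Matrix b a ℂ} {x : ℝ}
    (h : ((x : ℂ) • (1 : Matrix a a ℂ) - Wᴴ * W).PosSemidef) : TraceLE (conjBy W) x := by
  classical
  intro X hX
  obtain ⟨B, rfl⟩ : ∃ B : Matrix a a ℂ, X = B * Bᴴ := by
    open scoped MatrixOrder in
    obtain ⟨B, hB⟩ := CStarAlgebra.nonneg_iff_eq_star_mul_self.mp hX.nonneg
    exact ⟨Bᴴ, by simpa [star_eq_conjTranspose] using hB⟩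
  have h1 := trace_re_nonneg (h.conjTranspose_mul_mul_same B)
  have h2 : (SamplePhaseEstimation.conjBy W (B * Bᴴ)).trace = (Bᴴ * (Wᴴ * W) * B).trace := by
    change (W * (B * Bᴴ) * Wᴴ).trace = _
    rw [trace_mul_comm, ← Matrix.mul_assoc, ← Matrix.mul_assoc, trace_mul_comm, ← Matrix.mul_assoc]
  rw [h2]
  have h3 : Bᴴ * ((x : ℂ) • (1 : Matrix a a ℂ) - Wᴴ * W) * B
      = (x : ℂ) • (Bᴴ * B) - Bᴴ * (Wᴴ * W) * B := by
    rw [Matrix.mul_sub, Matrix.sub_mul]; simp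
  rw [h3, trace_sub, trace_smul, trace_mul_comm Bᴴ B] at h1
  simpa using h1

end trace

/-! ### Closeness of operations: a substitute for the diamond norm -/

/-- `Φ - Ψ` is a difference of completely positive maps whose sum increases the trace of positive
operators by at most the factor `δ`. -/
def Close {a b : Type} [Fintype a] [Fintype b] (Φ Ψ : SuperOp a b) (δ : ℝ) : Prop :=
  ∃ P Q : SuperOp a b, IsCP P ∧ IsCP Q ∧ Φ - Ψ = P - Q ∧ TraceLE (P + Q) δ

section Close
variable {a b c : Type} [Fintype a] [Fintype b] [Fintype c]

lemma Close.refl (Φ : SuperOp a b) : Close Φ Φ 0 :=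
  ⟨0, 0, IsCP.zero, IsCP.zero, by simp, fun X _ => by simp⟩

lemma Close.mono {Φ Ψ : SuperOp a b} {x y : ℝ} (h : Close Φ Ψ x) (hxy : x ≤ y) :
    Close Φ Ψ y := by
  obtain ⟨P, Q, hP, hQ, h, ht⟩ := h
  refine ⟨P, Q, hP, hQ, h, fun X hX => (ht X hX).trans ?_⟩
  gcongr
  exact trace_re_nonneg hX

lemma Close.trans {Φ Ψ Θ : SuperOp a b} {x y : ℝ} (h : Close Φ Ψ x) (h' : Close Ψ Θ y) :
    Close Φ Θ (x + y) := by
  obtain ⟨P, Q, hP, hQ, h, ht⟩ := h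
  obtain ⟨P', Q', hP', hQ', h', ht'⟩ := h'
  refine ⟨P + P', Q + Q', hP.add hP', hQ.add hQ', ?_, fun X hX => ?_⟩
  · rw [← sub_add_sub_cancel Φ Ψ Θ, h, h']; abel
  · have h1 := ht X hX
    have h2 := ht' X hX
    simp only [LinearMap.add_apply, trace_add, Complex.add_re] at *
    linarith

/-- Hybrid argument: `ΦΨ - Φ'Ψ' = (Φ - Φ')Ψ' + Φ(Ψ - Ψ')`. Only `Φ` and `Ψ'` survive next to a
difference, so only they need be positive and trace nonincreasing. -/
lemma Close.comp {Φ Φ' : SuperOp b c} {Ψ Ψ' : SuperOp a b} {x y : ℝ} (h : Close Φ Φ' x)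
    (h' : Close Ψ Ψ' y) (hx : 0 ≤ x) (hΦ : IsCP Φ) (hΦt : TraceLE Φ 1) (hΨ : IsCP Ψ')
    (hΨt : TraceLE Ψ' 1) : Close (Φ ∘ₗ Ψ) (Φ' ∘ₗ Ψ') (x + y) := by
  obtain ⟨P, Q, hP, hQ, h, ht⟩ := h
  obtain ⟨P', Q', hP', hQ', h', ht'⟩ := h'
  refine ⟨P ∘ₗ Ψ' + Φ ∘ₗ P', Q ∘ₗ Ψ' + Φ ∘ₗ Q', (hP.comp hΨ).add (hΦ.comp hP'),
    (hQ.comp hΨ).add (hΦ.comp hQ'), ?_, fun X hX => ?_⟩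
  · calc Φ ∘ₗ Ψ - Φ' ∘ₗ Ψ' = (Φ - Φ') ∘ₗ Ψ' + Φ ∘ₗ (Ψ - Ψ') := by
          rw [LinearMap.sub_comp, LinearMap.comp_sub]; abel
      _ = (P - Q) ∘ₗ Ψ' + Φ ∘ₗ (P' - Q') := by rw [h, h']
      _ = _ := by rw [LinearMap.sub_comp, LinearMap.comp_sub]; abel
  · have h1 := (ht _ (hΨ.posSemidef hX)).trans (mul_le_mul_of_nonneg_left (hΨt X hX) hx)
    have h2 := (hΦt _ ((hP'.add hQ').posSemidef hX)).trans
      (mul_le_mul_of_nonneg_left (ht' X hX) zero_le_one)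
    simp only [LinearMap.add_apply, LinearMap.comp_apply, map_add, trace_add,
      Complex.add_re] at *
    linarith

lemma Close.comp_left {Ψ Ψ' : SuperOp a b} {y : ℝ} (h : Close Ψ Ψ' y) {Φ : SuperOp b c}
    (hΦ : IsCP Φ) (hΦt : TraceLE Φ 1) : Close (Φ ∘ₗ Ψ) (Φ ∘ₗ Ψ') y := by
  obtain ⟨P', Q', hP', hQ', h', ht'⟩ := h
  refine ⟨Φ ∘ₗ P', Φ ∘ₗ Q', hΦ.comp hP', hΦ.comp hQ', ?_, fun X hX => ?_⟩
  · rw [← LinearMap.comp_sub, ← LinearMap.comp_sub, h']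
  · rw [← LinearMap.comp_add]
    exact (hΦt _ ((hP'.add hQ').posSemidef hX)).trans (by rw [one_mul]; exact ht' X hX)

lemma Close.comp_right {Φ Φ' : SuperOp b c} {x : ℝ} (h : Close Φ Φ' x) (hx : 0 ≤ x)
    {Ψ : SuperOp a b} (hΨ : IsCP Ψ) (hΨt : TraceLE Ψ 1) : Close (Φ ∘ₗ Ψ) (Φ' ∘ₗ Ψ) x := by
  obtain ⟨P, Q, hP, hQ, h, ht⟩ := h
  refine ⟨P ∘ₗ Ψ, Q ∘ₗ Ψ, hP.comp hΨ, hQ.comp hΨ, ?_, ?_⟩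
  · rw [← LinearMap.sub_comp, ← LinearMap.sub_comp, h]
  · rw [← LinearMap.add_comp]
    simpa using ht.comp hx hΨt hΨ

lemma IsCP.list_prod {l : List (SuperOp a a)} (h : ∀ Φ ∈ l, IsCP Φ) :
    IsCP (List.prod (α := Module.End ℂ (Matrix a a ℂ)) l) := by
  induction l with
  | nil => exact IsCP.id
  | cons Φ l ih =>
    rw [List.prod_cons]
    exact (h Φ (by simp)).comp (ih fun Ψ hΨ => h Ψ (by simp [hΨ]))

lemma TraceLE.id : TraceLE (LinearMap.id : SuperOp a a) 1 := fun X _ => by simp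

lemma TraceLE.list_prod {l : List (SuperOp a a)} (h : ∀ Φ ∈ l, IsCP Φ)
    (ht : ∀ Φ ∈ l, TraceLE Φ 1) :
    TraceLE (List.prod (α := Module.End ℂ (Matrix a a ℂ)) l) 1 := by
  induction l with
  | nil => exact TraceLE.id
  | cons Φ l ih =>
    rw [List.prod_cons]
    have := (ht Φ (by simp)).comp zero_le_one (ih (fun Ψ hΨ => h Ψ (by simp [hΨ]))
      fun Ψ hΨ => ht Ψ (by simp [hΨ])) (IsCP.list_prod fun Ψ hΨ => h Ψ (by simp [hΨ]))
    exact (one_mul (1 : ℝ)) ▸ this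

/-- Errors of operations add up along a circuit. -/
lemma Close.list_prod {ι : Type*} {F F' : ι → SuperOp a a} {x : ℝ} (hx : 0 ≤ x)
    (h : ∀ i, Close (F i) (F' i) x) (hF : ∀ i, IsCP (F i)) (hFt : ∀ i, TraceLE (F i) 1)
    (hF' : ∀ i, IsCP (F' i)) (hFt' : ∀ i, TraceLE (F' i) 1) (l : List ι) :
    Close (List.prod (α := Module.End ℂ (Matrix a a ℂ)) (l.map F))
      (List.prod (α := Module.End ℂ (Matrix a a ℂ)) (l.map F')) (l.length * x) := by
  induction l with
  | nil => simpa using Close.refl _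
  | cons i l ih =>
    rw [List.map_cons, List.map_cons, List.prod_cons, List.prod_cons]
    refine ((h i).comp ih hx (hF i) (hFt i) (IsCP.list_prod ?_)
      (TraceLE.list_prod ?_ ?_)).mono ?_
    · simpa using fun j _ => hF' j
    · simpa using fun j _ => hF' j
    · simpa using fun j _ => hFt' j
    · push_cast [List.length_cons]; linarith

lemma conjBy_apply {a b : Type} [Fintype a] (W : Matrix b a ℂ) (X : Matrix a a ℂ) : conjBy W X = W * X * Wᴴ := rfl

/-- Conjugations by nearby contractions are close. -/
lemma Close.conjBy {A B : Matrix b a ℂ} {δ : ℝ} (hδ : 0 < δ) (hA : TraceLE (conjBy A) 1)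
    (hB : TraceLE (conjBy B) 1) (hAB : TraceLE (conjBy (A - B)) (δ ^ 2)) :
    Close (conjBy A) (conjBy B) (2 * δ) := by
  have hδ' : (δ : ℂ) ≠ 0 := by exact_mod_cast hδ.ne'
  -- Polarization with `S = A + B` and `E = A - B`: the difference is `½ (S X E† + E X S†)`, itself
  -- a difference of conjugations by `S ± c E`. The choice `c = 2 / δ` balances the contributions of
  -- `S` and of `E`, whose squared size is `δ²`.
  have key1 : ∀ X : Matrix a a ℂ,
      (((δ / 8 : ℝ) : ℂ) • (A + B + ((2 / δ : ℝ) : ℂ) • (A - B)) * X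
          * (A + B + ((2 / δ : ℝ) : ℂ) • (A - B))ᴴ)
        - (((δ / 8 : ℝ) : ℂ) • (A + B - ((2 / δ : ℝ) : ℂ) • (A - B)) * X
          * (A + B - ((2 / δ : ℝ) : ℂ) • (A - B))ᴴ) = A * X * Aᴴ - B * X * Bᴴ := by
    intro X
    simp only [conjTranspose_add, conjTranspose_sub, conjTranspose_smul, Complex.star_def,
      Complex.conj_ofReal, Matrix.add_mul, Matrix.mul_add, Matrix.sub_mul, Matrix.mul_sub,
      Matrix.smul_mul, Matrix.mul_smul, smul_add, smul_sub, smul_smul]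
    push_cast
    match_scalars <;> field_simp <;> ring
  have key2 : ∀ X : Matrix a a ℂ,
      (((δ / 8 : ℝ) : ℂ) • (A + B + ((2 / δ : ℝ) : ℂ) • (A - B)) * X
          * (A + B + ((2 / δ : ℝ) : ℂ) • (A - B))ᴴ)
        + (((δ / 8 : ℝ) : ℂ) • (A + B - ((2 / δ : ℝ) : ℂ) • (A - B)) * X
          * (A + B - ((2 / δ : ℝ) : ℂ) • (A - B))ᴴ)
        = ((δ / 2 : ℝ) : ℂ) • (A * X * Aᴴ) + ((δ / 2 : ℝ) : ℂ) • (B * X * Bᴴ)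
          + ((1 / δ - δ / 4 : ℝ) : ℂ) • ((A - B) * X * (A - B)ᴴ) := by
    intro X
    simp only [conjTranspose_add, conjTranspose_sub, conjTranspose_smul, Complex.star_def,
      Complex.conj_ofReal, Matrix.add_mul, Matrix.mul_add, Matrix.sub_mul, Matrix.mul_sub,
      Matrix.smul_mul, Matrix.mul_smul, smul_add, smul_sub, smul_smul]
    push_cast
    match_scalars <;> field_simp <;> ring
  refine ⟨((δ / 8 : ℝ) : ℂ) •
      SamplePhaseEstimation.conjBy (A + B + ((2 / δ : ℝ) : ℂ) • (A - B)),
    ((δ / 8 : ℝ) : ℂ) • SamplePhaseEstimation.conjBy (A + B - ((2 / δ : ℝ) : ℂ) • (A - B)),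
    (IsCP.conjBy _).smul (by positivity), (IsCP.conjBy _).smul (by positivity), ?_,
    fun X hX => ?_⟩
  · ext1 X
    have := key1 X
    simp only [LinearMap.sub_apply, LinearMap.smul_apply, conjBy_apply, Matrix.smul_mul] at this ⊢
    exact this.symm
  · have hk := key2 X
    have h1 := hA X hX
    have h2 := hB X hX
    have h3 := hAB X hX
    have h4 := trace_re_nonneg ((IsCP.conjBy (A - B)).posSemidef hX)
    simp only [LinearMap.add_apply, LinearMap.smul_apply, conjBy_apply, Matrix.smul_mul]
      at hk h1 h2 h3 h4 ⊢
    rw [hk]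
    simp only [trace_add, trace_smul, Complex.add_re, smul_eq_mul, Complex.re_ofReal_mul]
    have h5 : 1 / δ * ((A - B) * X * (A - B)ᴴ).trace.re ≤ δ * X.trace.re := by
      calc _ ≤ 1 / δ * (δ ^ 2 * X.trace.re) := by gcongr
        _ = _ := by field_simp
    -- The terms in `A`, `B` and `A - B` contribute `δ / 2`, `δ / 2` and `δ`; the part with
    -- coefficient `-δ / 4` is dropped.
    nlinarith [mul_le_mul_of_nonneg_left h1 hδ.le, mul_le_mul_of_nonneg_left h2 hδ.le,
      mul_nonneg hδ.le h4]

/-- The trace norm of a difference of positive operators. -/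
lemma traceNorm_sub_le [DecidableEq a] {P Q : Matrix a a ℂ} (hP : P.PosSemidef)
    (hQ : Q.PosSemidef) : traceNorm (P - Q) ≤ P.trace.re + Q.trace.re := by
  have hH : (P - Q).IsHermitian := hP.1.sub hQ.1
  set A := P - Q
  let U : Matrix a a ℂ := (hH.eigenvectorUnitary : Matrix a a ℂ)
  have hUU : U * Uᴴ = 1 := by
    have := Unitary.coe_mul_star_self hH.eigenvectorUnitary
    simpa [star_eq_conjTranspose] using this
  have hdiag : Uᴴ * A * U = diagonal (fun i => (hH.eigenvalues i : ℂ)) := by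
    have := hH.conjStarAlgAut_star_eigenvectorUnitary
    rw [Unitary.conjStarAlgAut_star_apply] at this
    exact this
  have hsum : traceNorm A = ∑ i, |hH.eigenvalues i| := by
    -- The eigenvalues of `A A† = A²` are matched with the squares of those of `A` as multisets of
    -- roots of the characteristic polynomial, since the two enumerations need not agree index by
    -- index.
    have hsq : A * Aᴴ = cfc (fun x : ℝ => x ^ 2) A := by
      rw [cfc_pow_id A 2 hH.isSelfAdjoint, hH.eq, sq]
    have h1 := (isHermitian_mul_conjTranspose_self A).charpoly_eq
    have h2 := hH.charpoly_cfc_eq (fun x : ℝ => x ^ 2)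
    rw [← hsq, h1] at h2
    have h3 := congrArg Polynomial.roots h2
    rw [Polynomial.roots_prod _ _ (Finset.prod_ne_zero_iff.mpr fun _ _ =>
      Polynomial.X_sub_C_ne_zero _), Polynomial.roots_prod _ _ (Finset.prod_ne_zero_iff.mpr
      fun _ _ => Polynomial.X_sub_C_ne_zero _)] at h3
    simp only [Polynomial.roots_X_sub_C, Multiset.bind_singleton] at h3
    have h4 := congrArg (fun s => (s.map fun z : ℂ => Real.sqrt z.re).sum) h3
    simp only [Multiset.map_map, Function.comp_def, Complex.coe_algebraMap,
      Complex.ofReal_re, Real.sqrt_sq_eq_abs] at h4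
    exact h4
  have htr : ∀ B : Matrix a a ℂ, (Uᴴ * B * U).trace = B.trace := fun B => by
    rw [trace_mul_comm, ← Matrix.mul_assoc, hUU, Matrix.one_mul]
  rw [hsum, ← htr P, ← htr Q, trace, trace, Complex.re_sum, Complex.re_sum,
    ← Finset.sum_add_distrib]
  -- In the eigenbasis of `A`, each eigenvalue is a difference of nonnegative diagonal entries of
  -- `P` and `Q`.
  refine Finset.sum_le_sum fun i _ => ?_
  have hP' := (Complex.nonneg_iff.mp ((hP.conjTranspose_mul_mul_same U).diag_nonneg : 0 ≤ (Uᴴ * P * U) i i)).1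
  have hQ' := (Complex.nonneg_iff.mp ((hQ.conjTranspose_mul_mul_same U).diag_nonneg : 0 ≤ (Uᴴ * Q * U) i i)).1
  have hsub : Uᴴ * A * U = Uᴴ * P * U - Uᴴ * Q * U := by rw [← Matrix.sub_mul, ← Matrix.mul_sub]
  have h := congrArg Complex.re (congrFun (congrFun hdiag i) i)
  rw [hsub, diagonal_apply_eq, Complex.ofReal_re, Matrix.sub_apply,
    Complex.sub_re] at h
  rw [← h, diag_apply, diag_apply, abs_le]
  constructor <;> linarith

/-- Complete positivity and the trace bound both survive a reference, so `traceNorm_sub_le` applies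
to the two positive parts; the halving is the one in the definition of trace distance. -/
lemma Close.diamondDistLE [DecidableEq b] {Φ Ψ : SuperOp a b} {δ : ℝ} (h : Close Φ Ψ δ) :
    DiamondDistLE Φ Ψ (δ / 2) := by
  intro k σ hσ
  obtain ⟨P, Q, hP, hQ, h, ht⟩ := h
  have h1 : withReference (Fin k) Φ σ - withReference (Fin k) Ψ σ
      = withReference (Fin k) P σ - withReference (Fin k) Q σ := by
    ext p q
    exact congrFun (congrFun (LinearMap.congr_fun h _) p.1) q.1
  have h2 := ht.withReference (Fin k) σ hσ.1
  have h3 : withReference (Fin k) (P + Q) σ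
      = withReference (Fin k) P σ + withReference (Fin k) Q σ := rfl
  rw [h3, hσ.2, trace_add, Complex.add_re, Complex.one_re, mul_one] at h2
  rw [h1]
  linarith [traceNorm_sub_le (hP (Fin k) σ hσ.1) (hQ (Fin k) σ hσ.1)]

end Close

/-! ### Elements of the phase estimation circuit -/

section circuit
variable {d : Type} [Fintype d]

/-- Separating one qubit of the register, together with the target, from the other qubits. -/
def splitQubit {m : ℕ} (d : Type) (j : Fin m) :
    Reg m × d ≃ (Fin 2 × d) × ({i : Fin m // i ≠ j} → Fin 2) where
  toFun p := ((p.1 j, p.2), fun i => p.1 i)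
  invFun q := ((Equiv.funSplitAt j (Fin 2)).symm (q.1.1, q.2), q.1.2)
  left_inv p := Prod.ext ((Equiv.funSplitAt j (Fin 2)).symm_apply_apply p.1) rfl
  right_inv q := by
    have h := (Equiv.funSplitAt j (Fin 2)).apply_symm_apply (q.1.1, q.2)
    exact Prod.ext (Prod.ext (congrArg (fun z => z.1) h) rfl) (congrArg (fun z => z.2) h)

/-- The other register qubits play the role of a reference system, so positivity and trace bounds
transfer from `withReference`. -/
lemma onQubit_eq {d : Type} {m : ℕ} (j : Fin m) (G : SuperOp (Fin 2 × d) (Fin 2 × d)) :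
    onQubit j G = relabel (splitQubit d j) ∘ₗ
      withReference ({i : Fin m // i ≠ j} → Fin 2) G ∘ₗ relabel (splitQubit d j).symm := by
  refine LinearMap.ext fun X => Matrix.ext fun p q => ?_
  change G _ _ _ = G _ _ _
  congr 2

lemma IsCP.onQubit {m : ℕ} (j : Fin m) {G : SuperOp (Fin 2 × d) (Fin 2 × d)} (h : IsCP G) :
    IsCP (onQubit j G) := by
  rw [onQubit_eq]
  exact (IsCP.relabel _).comp ((h.withReference _).comp (IsCP.relabel _))

lemma TraceLE.onQubit {m : ℕ} (j : Fin m) {G : SuperOp (Fin 2 × d) (Fin 2 × d)} {x : ℝ}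
    (h : TraceLE G x) : TraceLE (onQubit j G) x := by
  intro X hX
  rw [onQubit_eq, LinearMap.comp_apply, IsTP.relabel, LinearMap.comp_apply]
  refine (h.withReference _ _ ((IsCP.relabel _).posSemidef hX)).trans ?_
  rw [IsTP.relabel]

lemma Close.onQubit {m : ℕ} (j : Fin m) {G G' : SuperOp (Fin 2 × d) (Fin 2 × d)} {x : ℝ}
    (h : Close G G' x) : Close (onQubit j G) (onQubit j G') x := by
  obtain ⟨P, Q, hP, hQ, h, ht⟩ := h
  refine ⟨_, _, hP.onQubit j, hQ.onQubit j, ?_, ht.onQubit j⟩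
  refine LinearMap.ext fun X => Matrix.ext fun p q => ?_
  exact congrFun (congrFun (LinearMap.congr_fun h _) _) _

lemma IsCP.initRegister (m : ℕ) : IsCP (initRegister m d) := by
  have h : (Matrix.single (0 : Reg m) (0 : Reg m) (1 : ℂ)).PosSemidef := by
    have := PosSemidef.diagonal (n := Reg m) (R := ℂ) (d := Pi.single 0 1)
      (by rw [Pi.single_nonneg]; exact zero_le_one)
    rwa [diagonal_single] at this
  have : SamplePhaseEstimation.initRegister m d = SamplePhaseEstimation.relabel Prod.swap ∘ₗ
      SamplePhaseEstimation.appendState (Matrix.single (0 : Reg m) (0 : Reg m) (1 : ℂ)) := by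
    refine LinearMap.ext fun X => Matrix.ext fun p q => mul_comm _ _
  rw [this]
  exact (IsCP.relabel _).comp (IsCP.appendState h)

lemma IsTP.initRegister (m : ℕ) : IsTP (initRegister m d) := by
  intro X
  change (_ ⊗ₖ _).trace = _
  rw [trace_kronecker, trace_single_eq_same, one_mul]

/-- Erasing the off-diagonal blocks is the sum, over outcomes, of conjugations by the outcome
projections. -/
lemma IsCP.measureRegister (m : ℕ) : IsCP (measureRegister m d) := by
  classical
  have : SamplePhaseEstimation.measureRegister m d = ∑ x : Reg m, SamplePhaseEstimation.conjBy
      (diagonal fun p : Reg m × d => if p.1 = x then (1 : ℂ) else 0) := by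
    refine LinearMap.ext fun X => Matrix.ext fun p q => ?_
    rw [LinearMap.sum_apply, Matrix.sum_apply]
    simp only [conjBy_apply, diagonal_conjTranspose, mul_diagonal, diagonal_mul]
    by_cases h : p.1 = q.1 <;>
      simp [SamplePhaseEstimation.measureRegister, apply_ite, h]
  rw [this]
  exact IsCP.sum _ fun x _ => IsCP.conjBy _

lemma IsTP.measureRegister (m : ℕ) : IsTP (measureRegister m d) := by
  intro X
  simp [SamplePhaseEstimation.measureRegister, trace]

end circuit

/-! ### Fourier transform, Hadamard gates and tensor powers -/

section fourier

/-- Uniqueness of binary digits; it turns sums over the register into geometric sums. -/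
lemma sum_reg {E : Type*} [AddCommMonoid E] (m : ℕ) (f : ℕ → E) :
    ∑ x : Reg m, f (regVal x) = ∑ n ∈ Finset.range (2 ^ m), f n := by
  rw [Finset.sum_range, ← finFunctionFinEquiv.sum_comp]
  exact Finset.sum_congr rfl fun x _ => by rw [finFunctionFinEquiv_apply]; rfl

lemma regVal_lt {m : ℕ} (x : Reg m) : regVal x < 2 ^ m := by
  have := (finFunctionFinEquiv x).isLt
  rwa [finFunctionFinEquiv_apply] at this

lemma regVal_injective {m : ℕ} : Function.Injective (regVal : Reg m → ℕ) := by
  intro x y h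
  apply finFunctionFinEquiv.injective
  apply Fin.ext
  rwa [finFunctionFinEquiv_apply, finFunctionFinEquiv_apply]

/-- Orthogonality of the characters of `ℤ/M`. -/
lemma sum_exp_pow {M : ℕ} (hM : 0 < M) {a : ℤ} (ha : |a| < M) :
    ∑ n ∈ Finset.range M, Complex.exp (2 * Real.pi * Complex.I * (a / M)) ^ n
      = if a = 0 then (M : ℂ) else 0 := by
  split_ifs with h
  · simp [h]
  have hM' : (M : ℂ) ≠ 0 := by exact_mod_cast hM.ne'
  have h1 : Complex.exp (2 * Real.pi * Complex.I * (a / M)) ≠ 1 := by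
    rw [Ne, Complex.exp_eq_one_iff]
    rintro ⟨n, hn⟩
    have h2 : (a : ℂ) = n * M := by
      have : (2 * Real.pi * Complex.I : ℂ) ≠ 0 := Complex.two_pi_I_ne_zero
      field_simp at hn
      rw [hn, mul_comm]
    have h3 : a = n * M := by exact_mod_cast h2
    exact h (Int.eq_zero_of_abs_lt_dvd ⟨n, by rw [h3, mul_comm]⟩ ha)
  rw [geom_sum_eq h1, ← Complex.exp_nat_mul]
  have : (M : ℂ) * (2 * Real.pi * Complex.I * (a / M)) = a * (2 * Real.pi * Complex.I) := by
    field_simp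
  rw [this, Complex.exp_int_mul_two_pi_mul_I, sub_self, zero_div]

lemma qft_mul_conjTranspose (m : ℕ) : qft m * (qft m)ᴴ = 1 := by
  ext x y
  have hM : (0 : ℝ) < 2 ^ m := by positivity
  have hterm : ∀ k : Reg m, qft m x k * (qft m)ᴴ k y = ((2 : ℂ) ^ m)⁻¹ *
      Complex.exp (2 * Real.pi * Complex.I *
        (((regVal x - regVal y : ℤ) : ℂ) / ((2 ^ m : ℕ) : ℂ))) ^ regVal k := by
    intro k
    have h1 : (((Real.sqrt (2 ^ m))⁻¹ : ℝ) : ℂ) * (((Real.sqrt (2 ^ m))⁻¹ : ℝ) : ℂ)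
        = ((2 : ℂ) ^ m)⁻¹ := by
      rw [← Complex.ofReal_mul, ← mul_inv, Real.mul_self_sqrt hM.le]; push_cast; rfl
    rw [← Complex.exp_nat_mul, ← h1, conjTranspose_apply]
    simp only [qft, of_apply, star_mul', Complex.star_def, Complex.conj_ofReal, ← Complex.exp_conj]
    rw [mul_mul_mul_comm, ← Complex.exp_add]
    congr 2
    simp only [map_div₀, map_mul, map_ofNat, Complex.conj_ofReal, Complex.conj_I, map_natCast,
      map_pow]
    push_cast
    field_simp
    ring
  rw [mul_apply, Finset.sum_congr rfl fun k _ => hterm k, ← Finset.mul_sum,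
    sum_reg m fun n => Complex.exp (2 * Real.pi * Complex.I *
        (((regVal x - regVal y : ℤ) : ℂ) / ((2 ^ m : ℕ) : ℂ))) ^ n, sum_exp_pow (by positivity)]
  · rw [one_apply]
    by_cases h : x = y
    · simp [h]
    · have : ¬ ((regVal x : ℤ) - regVal y = 0) := fun h' =>
        h (regVal_injective (by exact_mod_cast sub_eq_zero.mp h'))
      simp [h, this]
  · have h1 := regVal_lt x
    have h2 := regVal_lt y
    rw [abs_lt]
    constructor <;> omega

lemma hadamard_mul_self : hadamardᴴ * hadamard = 1 := by
  have h : ((Real.sqrt 2)⁻¹ : ℂ) * ((Real.sqrt 2)⁻¹ : ℂ) = 1 / 2 := by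
    rw [← mul_inv, ← Complex.ofReal_mul, Real.mul_self_sqrt (by norm_num)]; norm_num
  ext i j
  fin_cases i <;> fin_cases j <;>
    simp [hadamard, mul_apply, Fin.sum_univ_two, h] <;> norm_num

lemma tensorPower_mul {a : Type} [Fintype a] (A B : Matrix a a ℂ) (n : ℕ) :
    tensorPower A n * tensorPower B n = tensorPower (A * B) n := by
  ext f g
  simp only [mul_apply, tensorPower, of_apply, ← Finset.prod_mul_distrib]
  rw [Finset.prod_univ_sum, Fintype.piFinset_univ]

lemma tensorPower_one {a : Type} [Fintype a] [DecidableEq a] (n : ℕ) :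
    tensorPower (1 : Matrix a a ℂ) n = 1 := by
  ext f g
  simp only [tensorPower, of_apply, one_apply, Finset.prod_ite_zero, funext_iff]
  simp

lemma tensorPower_conjTranspose {a : Type} (A : Matrix a a ℂ) (n : ℕ) :
    (tensorPower A n)ᴴ = tensorPower Aᴴ n := by
  ext f g
  simp [tensorPower]

lemma IsTP.conjBy_kronecker_one {a d : Type} [Fintype a] [DecidableEq a] [Fintype d]
    [DecidableEq d] {W : Matrix a a ℂ} (h : Wᴴ * W = 1) :
    IsTP (SamplePhaseEstimation.conjBy (W ⊗ₖ (1 : Matrix d d ℂ))) := by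
  refine IsTP.conjBy ?_
  rw [conjTranspose_kronecker, ← mul_kronecker_mul, h, conjTranspose_one, one_mul,
    one_kronecker_one]

end fourier

lemma length_controlSchedule (m : ℕ) : (controlSchedule m).length = 2 ^ m - 1 := by
  simp only [controlSchedule, List.length_flatMap, List.length_replicate]
  rw [← Fin.sum_univ_def, Fin.sum_univ_eq_sum_range (fun i => 2 ^ i) m, Nat.geomSum_eq le_rfl]
  simp

/-! ### Error propagation through phase estimation -/

section phaseEstimation
variable {d : Type} [Fintype d] [DecidableEq d]

/-- Replacing every use of the controlled unitary by an approximation. -/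
lemma Close.phaseEstimation (m : ℕ) {G G' : SuperOp (Fin 2 × d) (Fin 2 × d)} {x : ℝ}
    (hx : 0 ≤ x) (h : Close G G' x) (hG : IsCP G) (hGt : TraceLE G 1) (hG' : IsCP G')
    (hGt' : TraceLE G' 1) :
    Close (SamplePhaseEstimation.phaseEstimation m G)
      (SamplePhaseEstimation.phaseEstimation m G') ((2 ^ m - 1 : ℕ) * x) := by
  have hl := Close.list_prod hx (fun j : Fin m => h.onQubit j) (fun j => hG.onQubit j)
    (fun j => hGt.onQubit j) (fun j => hG'.onQubit j) (fun j => hGt'.onQubit j)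
    (controlSchedule m)
  rw [length_controlSchedule] at hl
  have hH : IsTP (SamplePhaseEstimation.conjBy (tensorPower hadamard m ⊗ₖ (1 : Matrix d d ℂ))) :=
    IsTP.conjBy_kronecker_one (by
      rw [tensorPower_conjTranspose, tensorPower_mul, hadamard_mul_self, tensorPower_one])
  have hQ : IsTP (SamplePhaseEstimation.conjBy ((qft m)ᴴ ⊗ₖ (1 : Matrix d d ℂ))) :=
    IsTP.conjBy_kronecker_one (by
      rw [conjTranspose_conjTranspose, qft_mul_conjTranspose])
  exact (((hl.comp_right (by positivity) ((IsCP.conjBy _).comp (IsCP.initRegister m))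
    (hH.comp (IsTP.initRegister m)).traceLE).comp_left (IsCP.conjBy _) hQ.traceLE).comp_left
      (IsCP.measureRegister m) (IsTP.measureRegister m).traceLE)

end phaseEstimation

/-! ### Density matrix exponentiation -/

section lmr
variable {d : Type} [Fintype d] [DecidableEq d]

/-- The swap of two systems, restricted to control qubit `1` (and zero on control qubit `0`). -/
def ctrlSwap (d : Type) [DecidableEq d] : Matrix ((Fin 2 × d) × d) ((Fin 2 × d) × d) ℂ :=
  Matrix.of fun p q => if p.1.1 = 1 ∧ q = ((1, p.2), p.1.2) then 1 else 0

/-- The diagonal gate with entries `1` and `cos t` on the control qubit. -/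
def dampedControl (d : Type) [DecidableEq d] (t : ℝ) : Matrix (Fin 2 × d) (Fin 2 × d) ℂ :=
  diagonal fun i => if i.1 = 0 then 1 else (Real.cos t : ℂ)

/-- The controlled partial swap `|0⟩⟨0| ⊗ 1 + |1⟩⟨1| ⊗ exp(-i t SWAP)`. -/
def ctrlPartialSwap (d : Type) [DecidableEq d] (t : ℝ) :
    Matrix ((Fin 2 × d) × d) ((Fin 2 × d) × d) ℂ :=
  dampedControl d t ⊗ₖ (1 : Matrix d d ℂ) - (Complex.I * Real.sin t) • ctrlSwap d

lemma ctrlSwap_conjTranspose {d : Type} [DecidableEq d] : (ctrlSwap d)ᴴ = ctrlSwap d := by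
  ext ⟨⟨i, a⟩, b⟩ ⟨⟨j, a'⟩, b'⟩
  simp only [ctrlSwap, conjTranspose_apply, of_apply, Prod.mk.injEq, apply_ite, star_one, star_zero]
  split_ifs <;> first | rfl | (exfalso; tauto)

lemma dampedControl_conjTranspose {d : Type} [DecidableEq d] (t : ℝ) :
    (dampedControl d t)ᴴ = dampedControl d t := by
  rw [dampedControl, diagonal_conjTranspose]
  congr 1
  ext i
  rw [Pi.star_apply]
  split_ifs <;> simp [-Complex.ofReal_cos]

lemma ctrlSwap_mul_self :
    ctrlSwap d * ctrlSwap d = diagonal fun p => if p.1.1 = 0 then 0 else 1 := by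
  ext ⟨⟨i, a⟩, b⟩ ⟨⟨j, a'⟩, b'⟩
  rw [mul_apply, Finset.sum_eq_single ((1, b), a)]
  · fin_cases i <;> fin_cases j <;> simp [ctrlSwap, diagonal_apply, eq_comm]
  · intro q _ hq
    simp [ctrlSwap, hq]
  · simp

lemma dampedControl_mul_ctrlSwap (t : ℝ) :
    (dampedControl d t ⊗ₖ (1 : Matrix d d ℂ)) * ctrlSwap d = (Real.cos t : ℂ) • ctrlSwap d := by
  rw [dampedControl, ← diagonal_one, diagonal_kronecker_diagonal]
  ext ⟨⟨i, a⟩, b⟩ q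
  rw [diagonal_mul]
  fin_cases i <;> simp [ctrlSwap]

lemma ctrlSwap_mul_dampedControl (t : ℝ) :
    ctrlSwap d * (dampedControl d t ⊗ₖ (1 : Matrix d d ℂ)) = (Real.cos t : ℂ) • ctrlSwap d := by
  rw [dampedControl, ← diagonal_one, diagonal_kronecker_diagonal]
  ext p ⟨⟨i, a⟩, b⟩
  rw [mul_diagonal]
  fin_cases i <;> simp [ctrlSwap]

lemma ctrlPartialSwap_conjTranspose {d : Type} [DecidableEq d] (t : ℝ) : (ctrlPartialSwap d t)ᴴ
    = dampedControl d t ⊗ₖ (1 : Matrix d d ℂ) + (Complex.I * Real.sin t) • ctrlSwap d := by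
  rw [ctrlPartialSwap, conjTranspose_sub, conjTranspose_kronecker, dampedControl_conjTranspose,
    conjTranspose_one, conjTranspose_smul, ctrlSwap_conjTranspose, star_mul', Complex.star_def,
    Complex.conj_I, Complex.conj_ofReal, neg_mul, neg_smul, sub_neg_eq_add]

/-- The restricted swap squares to the projection onto control `1`, where the diagonal gate acts as
`cos t`. The cross terms cancel and `cos² + sin² = 1` remains. -/
lemma ctrlPartialSwap_unitary (t : ℝ) :
    (ctrlPartialSwap d t)ᴴ * ctrlPartialSwap d t = 1 := by
  rw [ctrlPartialSwap_conjTranspose, ctrlPartialSwap, Matrix.add_mul, Matrix.mul_sub,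
    Matrix.mul_sub, Matrix.mul_smul, Matrix.smul_mul, Matrix.smul_mul, Matrix.mul_smul,
    dampedControl_mul_ctrlSwap, ctrlSwap_mul_dampedControl, ctrlSwap_mul_self,
    ← mul_kronecker_mul, one_mul, dampedControl, diagonal_mul_diagonal]
  have h : (Real.cos t : ℂ) * Real.cos t - Complex.I * Real.sin t * (Complex.I * Real.sin t) = 1 := by
    have := Complex.cos_sq_add_sin_sq t
    push_cast
    linear_combination this - Complex.sin t ^ 2 * Complex.I_sq
  rw [← diagonal_one, diagonal_kronecker_diagonal]
  rw [sub_add_sub_cancel, ← diagonal_smul, ← diagonal_smul, diagonal_sub]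
  congr 1
  ext ⟨⟨i, a⟩, b⟩
  fin_cases i
  · simp
  · simpa using h

/-- One step of density matrix exponentiation: a controlled partial swap with a copy of the
state, which is then discarded. -/
def lmrStep (d : Type) [Fintype d] [DecidableEq d] (t : ℝ) :
    SuperOp ((Fin 2 × d) × d) (Fin 2 × d) :=
  partialTrace ∘ₗ conjBy (ctrlPartialSwap d t)

lemma IsCP.lmrStep (t : ℝ) : IsCP (lmrStep d t) := IsCP.partialTrace.comp (IsCP.conjBy _)

lemma IsTP.lmrStep (t : ℝ) : IsTP (lmrStep d t) :=
  IsTP.partialTrace.comp (IsTP.conjBy (ctrlPartialSwap_unitary t))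

lemma partialTrace_apply {a c : Type} [Fintype c] (X : Matrix (a × c) (a × c) ℂ) (p q : a) :
    partialTrace X p q = ∑ i, X (p, i) (q, i) := by
  simp [partialTrace, Matrix.sum_apply]

/-- The swap trick: discarding a swapped-in copy leaves multiplication by `ρ`. This is how copies of
the state come to act as a Hamiltonian. -/
lemma partialTrace_ctrlSwap_mul (Y : Matrix (Fin 2 × d) (Fin 2 × d) ℂ) (ρ : Matrix d d ℂ) :
    partialTrace (ctrlSwap d * (Y ⊗ₖ ρ)) = (Matrix.single 1 1 (1 : ℂ) ⊗ₖ ρ) * Y := by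
  ext ⟨i, a⟩ q
  have h : ∀ c : d, (ctrlSwap d * (Y ⊗ₖ ρ)) ((i, a), c) (q, c)
      = if i = 1 then Y (1, c) q * ρ a c else 0 := by
    intro c
    rw [mul_apply, Finset.sum_eq_single ((1, c), a)]
    · simp [ctrlSwap]
    · intro q _ hq
      simp [ctrlSwap, hq]
    · simp
  rw [partialTrace_apply, Finset.sum_congr rfl fun c _ => h c, mul_apply, Fintype.sum_prod_type]
  fin_cases i <;> simp [mul_comm]

lemma partialTrace_mul_ctrlSwap (Y : Matrix (Fin 2 × d) (Fin 2 × d) ℂ) (ρ : Matrix d d ℂ) :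
    partialTrace ((Y ⊗ₖ ρ) * ctrlSwap d) = Y * (Matrix.single 1 1 (1 : ℂ) ⊗ₖ ρ) := by
  ext p ⟨i, a⟩
  have h : ∀ c : d, ((Y ⊗ₖ ρ) * ctrlSwap d) (p, c) ((i, a), c)
      = if i = 1 then Y p (1, c) * ρ c a else 0 := by
    intro c
    rw [mul_apply, Finset.sum_eq_single ((1, c), a)]
    · simp [ctrlSwap]
    · rintro ⟨⟨j, b⟩, e⟩ _ hq
      have : ¬ (j = 1 ∧ ((i, a), c) = (((1 : Fin 2), e), b)) := by
        rintro ⟨rfl, h⟩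
        simp only [Prod.mk.injEq] at h
        exact hq (by rw [h.2, h.1.2])
      simp only [ctrlSwap, of_apply, if_neg this, mul_zero]
    · simp
  rw [partialTrace_apply, Finset.sum_congr rfl fun c _ => h c, mul_apply, Fintype.sum_prod_type]
  fin_cases i <;> simp

lemma partialTrace_kronecker {a c : Type} [Fintype c] (Y : Matrix a a ℂ) (ρ : Matrix c c ℂ) :
    partialTrace (Y ⊗ₖ ρ) = ρ.trace • Y := by
  ext p q
  simp [partialTrace_apply, trace, ← Finset.mul_sum, mul_comm]

/-- The gate `|0⟩⟨0| ⊗ 1 + |1⟩⟨1| ⊗ (cos t - i ρ sin t)`. -/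
def lmrKraus (ρ : Matrix d d ℂ) (t : ℝ) : Matrix (Fin 2 × d) (Fin 2 × d) ℂ :=
  dampedControl d t - (Complex.I * Real.sin t) • (Matrix.single 1 1 (1 : ℂ) ⊗ₖ ρ)

/-- Expanding both conjugations in `i sin t`, the terms of order zero and one coincide by the swap
trick and `Tr ρ = 1`. Only the quadratic terms differ, so the identity is exact. -/
lemma lmrStep_kronecker {ρ : Matrix d d ℂ} (hρ : IsDensity ρ) (t : ℝ)
    (X : Matrix (Fin 2 × d) (Fin 2 × d) ℂ) :
    lmrStep d t (X ⊗ₖ ρ) = conjBy (lmrKraus ρ t) X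
      + (((Real.sin t) ^ 2 : ℝ) : ℂ) • partialTrace (conjBy (ctrlSwap d) (X ⊗ₖ ρ))
      - (((Real.sin t) ^ 2 : ℝ) : ℂ) • conjBy (Matrix.single 1 1 (1 : ℂ) ⊗ₖ ρ) X := by
  set E := Matrix.single (1 : Fin 2) (1 : Fin 2) (1 : ℂ) ⊗ₖ ρ with hE
  set s := Complex.I * Real.sin t with hs
  set D := dampedControl d t with hD
  have hEH : Eᴴ = E := by
    rw [hE, conjTranspose_kronecker, hρ.1.1.eq, conjTranspose_single, star_one]
  have hKH : (lmrKraus ρ t)ᴴ = D + s • E := by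
    rw [lmrKraus, conjTranspose_sub, dampedControl_conjTranspose, conjTranspose_smul, ← hE, hEH,
      star_mul', Complex.star_def, Complex.conj_I, Complex.conj_ofReal, neg_mul,
      neg_smul, sub_neg_eq_add]
  have hs2 : s * s = -(((Real.sin t) ^ 2 : ℝ) : ℂ) := by
    rw [hs]; push_cast
    linear_combination Complex.sin t ^ 2 * Complex.I_sq
  have hexp : conjBy (ctrlPartialSwap d t) (X ⊗ₖ ρ) = (D * X * D) ⊗ₖ ρ
      + s • (((D * X) ⊗ₖ ρ) * ctrlSwap d) - s • (ctrlSwap d * ((X * D) ⊗ₖ ρ))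
      - (s * s) • conjBy (ctrlSwap d) (X ⊗ₖ ρ) := by
    have h1 : (D ⊗ₖ (1 : Matrix d d ℂ)) * (X ⊗ₖ ρ) = (D * X) ⊗ₖ ρ := by
      rw [← mul_kronecker_mul, one_mul]
    have h2 : ((D * X) ⊗ₖ ρ) * (D ⊗ₖ (1 : Matrix d d ℂ)) = (D * X * D) ⊗ₖ ρ := by
      rw [← mul_kronecker_mul, mul_one]
    have h3 : (X ⊗ₖ ρ) * (D ⊗ₖ (1 : Matrix d d ℂ)) = (X * D) ⊗ₖ ρ := by
      rw [← mul_kronecker_mul, mul_one]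
    rw [conjBy_apply, conjBy_apply, ctrlPartialSwap_conjTranspose, ctrlPartialSwap,
      ctrlSwap_conjTranspose, ← hD, ← hs, Matrix.sub_mul, h1, Matrix.sub_mul, Matrix.mul_add, h2,
      Matrix.mul_add, Matrix.smul_mul, Matrix.smul_mul, Matrix.smul_mul, Matrix.mul_smul,
      Matrix.mul_smul, Matrix.mul_assoc (ctrlSwap d) _ (D ⊗ₖ _), h3, smul_smul]
    abel
  rw [lmrStep, LinearMap.comp_apply, hexp, map_sub, map_sub, map_add, map_smul, map_smul, map_smul,
    partialTrace_kronecker, hρ.2, one_smul, partialTrace_mul_ctrlSwap, partialTrace_ctrlSwap_mul,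
    ← hE, conjBy_apply (lmrKraus ρ t), hKH, lmrKraus, ← hE, ← hD, ← hs, conjBy_apply E, hEH, hs2,
    Matrix.sub_mul, Matrix.sub_mul, Matrix.mul_add, Matrix.mul_add, Matrix.mul_smul,
    Matrix.mul_smul, Matrix.smul_mul, Matrix.smul_mul, Matrix.smul_mul, smul_smul, hs2,
    Matrix.mul_assoc E X D]
  simp only [neg_smul]
  abel

/-- The last copy of a batch, separated from the others. -/
def splitCopy (a d : Type) (r : ℕ) : (a × d) × (Fin r → d) ≃ a × (Fin (r + 1) → d) where
  toFun q := (q.1.1, Fin.cons q.1.2 q.2)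
  invFun p := ((p.1, p.2 0), Fin.tail p.2)
  left_inv q := by simp
  right_inv p := by simp

/-- Density matrix exponentiation with a control qubit, consuming `r` copies of the state. -/
def lmr (d : Type) [Fintype d] [DecidableEq d] (t : ℝ) :
    (r : ℕ) → SuperOp ((Fin 2 × d) × (Fin r → d)) (Fin 2 × d)
  | 0 => relabel (Equiv.prodUnique (Fin 2 × d) (Fin 0 → d)).symm
  | r + 1 => lmr d t r ∘ₗ withReference (Fin r → d) (lmrStep d t) ∘ₗ
      relabel (splitCopy (Fin 2 × d) d r)

lemma IsCP.lmr (t : ℝ) (r : ℕ) : IsCP (lmr d t r) := by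
  induction r with
  | zero => exact IsCP.relabel _
  | succ r ih => exact ih.comp (((IsCP.lmrStep t).withReference _).comp (IsCP.relabel _))

lemma IsTP.lmr (t : ℝ) (r : ℕ) : IsTP (lmr d t r) := by
  induction r with
  | zero => exact IsTP.relabel _
  | succ r ih => exact ih.comp (((IsTP.lmrStep t).withReference _).comp (IsTP.relabel _))

lemma isChannel_lmr (t : ℝ) (r : ℕ) : IsChannel (lmr d t r) :=
  ⟨fun k X hX => IsCP.lmr t r (Fin k) X hX, IsTP.lmr t r⟩

lemma withReference_kronecker {a b : Type} (K : Type) (Φ : SuperOp a b) (X : Matrix a a ℂ)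
    (Y : Matrix K K ℂ) : withReference K Φ (X ⊗ₖ Y) = Φ X ⊗ₖ Y := by
  ext p q
  have : (X ⊗ₖ Y).submatrix (fun c => (c, p.2)) (fun c => (c, q.2)) = Y p.2 q.2 • X := by
    ext c c'
    simp [mul_comm]
  rw [withReference_apply, this, map_smul]
  simp [mul_comm]

/-- The supplied copies are in a product state and each step consumes its own factor, so the batch
acts as a power of the one-copy operation. -/
lemma withCopies_lmr (ρ : Matrix d d ℂ) (t : ℝ) (r : ℕ) :
    withCopies r (lmr d t r) ρ =
      ((lmrStep d t ∘ₗ appendState ρ : SuperOp (Fin 2 × d) (Fin 2 × d)) :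
        Module.End ℂ (Matrix (Fin 2 × d) (Fin 2 × d) ℂ)) ^ r := by
  induction r with
  | zero =>
    refine LinearMap.ext fun X => Matrix.ext fun p q => ?_
    change X p q * tensorPower ρ 0 _ _ = X p q
    simp [tensorPower]
  | succ r ih =>
    rw [pow_succ, ← ih]
    refine LinearMap.ext fun X => ?_
    change lmr d t r (withReference _ (lmrStep d t) ((X ⊗ₖ tensorPower ρ (r + 1)).submatrix
      (splitCopy (Fin 2 × d) d r) (splitCopy (Fin 2 × d) d r)))
      = lmr d t r (lmrStep d t (X ⊗ₖ ρ) ⊗ₖ tensorPower ρ r)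
    rw [← withReference_kronecker]
    congr 2
    ext p q
    simp [splitCopy, tensorPower, Fin.prod_univ_succ, mul_assoc]

end lmr

/-! ### Operators diagonal in a fixed orthonormal basis -/

section diagonal
variable {n : Type} [Fintype n] [DecidableEq n]

/-- A normal operator with eigenvectors the columns of `R`. -/
def spectralOp (R : Matrix n n ℂ) (f : n → ℂ) : Matrix n n ℂ := R * diagonal f * Rᴴ

variable {R : Matrix n n ℂ}

lemma spectralOp_sub (f g : n → ℂ) :
    spectralOp R f - spectralOp R g = spectralOp R (f - g) := by
  rw [spectralOp, spectralOp, spectralOp, ← Matrix.sub_mul, ← Matrix.mul_sub, diagonal_sub]; rfl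

lemma spectralOp_add (f g : n → ℂ) :
    spectralOp R f + spectralOp R g = spectralOp R (f + g) := by
  rw [spectralOp, spectralOp, spectralOp, ← Matrix.add_mul, ← Matrix.mul_add, diagonal_add]; rfl

lemma spectralOp_smul (s : ℂ) (f : n → ℂ) : s • spectralOp R f = spectralOp R (s • f) := by
  rw [spectralOp, spectralOp, ← Matrix.smul_mul, ← Matrix.mul_smul, diagonal_smul]

lemma spectralOp_conjTranspose (f : n → ℂ) : (spectralOp R f)ᴴ = spectralOp R (star f) := by
  simp [spectralOp, Matrix.mul_assoc]

lemma spectralOp_mul (hR : Rᴴ * R = 1) (f g : n → ℂ) :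
    spectralOp R f * spectralOp R g = spectralOp R (f * g) := by
  calc _ = R * (diagonal f * (Rᴴ * R) * diagonal g) * Rᴴ := by
        simp only [spectralOp, Matrix.mul_assoc]
    _ = _ := by rw [hR, Matrix.mul_one, diagonal_mul_diagonal]; rfl

lemma spectralOp_one (hR : R * Rᴴ = 1) : spectralOp R 1 = 1 := by
  rw [spectralOp, Pi.one_def, diagonal_one, Matrix.mul_one, hR]

lemma spectralOp_pow (hR : Rᴴ * R = 1) (hR' : R * Rᴴ = 1) (f : n → ℂ) (k : ℕ) :
    spectralOp R f ^ k = spectralOp R (f ^ k) := by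
  induction k with
  | zero => rw [pow_zero, pow_zero, spectralOp_one hR']
  | succ k ih => rw [pow_succ, pow_succ, ih, spectralOp_mul hR]

/-- Here `W† W` is diagonal in the same basis with entries `|f i|²`, so operator norm bounds reduce
to bounds on scalars. -/
lemma TraceLE.conjBy_spectralOp (hR : Rᴴ * R = 1) (hR' : R * Rᴴ = 1) {f : n → ℂ} {x : ℝ}
    (hf : ∀ i, ‖f i‖ ^ 2 ≤ x) : TraceLE (SamplePhaseEstimation.conjBy (spectralOp R f)) x := by
  refine TraceLE.conjBy ?_
  rw [spectralOp_conjTranspose, spectralOp_mul hR, ← spectralOp_one hR', spectralOp_smul,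
    spectralOp_sub]
  refine (PosSemidef.diagonal fun i => ?_).mul_mul_conjTranspose_same R
  have h : (star f * f) i = ((‖f i‖ ^ 2 : ℝ) : ℂ) := by
    simp [Complex.conj_mul']
  simp only [Pi.sub_apply, Pi.smul_apply, Pi.one_apply, Pi.zero_apply, smul_eq_mul, mul_one, h]
  rw [← Complex.ofReal_sub]
  exact_mod_cast sub_nonneg.mpr (hf i)

lemma conjBy_pow (A : Matrix n n ℂ) (k : ℕ) :
    (conjBy A : Module.End ℂ (Matrix n n ℂ)) ^ k = conjBy (A ^ k) := by
  induction k with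
  | zero => ext1 X; simp [conjBy_apply]
  | succ k ih =>
    rw [pow_succ, ih]
    refine LinearMap.ext fun X => ?_
    rw [Module.End.mul_apply, conjBy_apply, conjBy_apply, conjBy_apply, pow_succ,
      conjTranspose_mul]
    simp only [Matrix.mul_assoc]

end diagonal

/-! ### Spectral decomposition of the state and of the controlled gates -/

section spectral
variable {d : Type} [Fintype d] [DecidableEq d]

/-- Nonnegative eigenvalues with sum one are each at most one; this bound, independent of the
dimension, feeds the scalar estimates. -/
lemma exists_spectralOp_of_isDensity {ρ : Matrix d d ℂ} (hρ : IsDensity ρ) :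
    ∃ (Q : Matrix d d ℂ) (p : d → ℝ), Qᴴ * Q = 1 ∧ Q * Qᴴ = 1 ∧ (∀ i, 0 ≤ p i) ∧ (∀ i, p i ≤ 1) ∧
      ρ = spectralOp Q fun i => (p i : ℂ) := by
  have hH := hρ.1.1
  have hnn := hρ.1.eigenvalues_nonneg
  refine ⟨hH.eigenvectorUnitary, hH.eigenvalues, ?_, ?_, hnn, fun i => ?_, ?_⟩
  · simpa [star_eq_conjTranspose] using Unitary.coe_star_mul_self hH.eigenvectorUnitary
  · simpa [star_eq_conjTranspose] using Unitary.coe_mul_star_self hH.eigenvectorUnitary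
  · have h := hH.trace_eq_sum_eigenvalues
    rw [hρ.2] at h
    have h' : ∑ i, hH.eigenvalues i = 1 := by
      have := congrArg Complex.re h.symm
      rwa [Complex.re_sum] at this
    rw [← h']
    exact Finset.single_le_sum (fun j _ => hnn j) (Finset.mem_univ i)
  · have h := hH.spectral_theorem
    rw [Unitary.conjStarAlgAut_apply] at h
    exact h

lemma exp_spectralOp {Q : Matrix d d ℂ} (hQ' : Q * Qᴴ = 1) (f : d → ℂ) :
    NormedSpace.exp (spectralOp Q f) = spectralOp Q fun i => Complex.exp (f i) := by
  have hinv : Q⁻¹ = Qᴴ := inv_eq_right_inv hQ'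
  have hu : IsUnit Q := IsUnit.of_mul_eq_one _ hQ'
  rw [spectralOp, ← hinv, exp_conj _ _ hu, exp_diagonal, hinv, spectralOp]
  congr 3
  ext i
  rw [Pi.coe_exp, Complex.exp_eq_exp_ℂ]

lemma kronecker_spectralOp {Q : Matrix d d ℂ} (i : Fin 2) (f : d → ℂ) :
    Matrix.single i i (1 : ℂ) ⊗ₖ spectralOp Q f
      = spectralOp ((1 : Matrix (Fin 2) (Fin 2) ℂ) ⊗ₖ Q) fun x => if x.1 = i then f x.2 else 0 := by
  have h : (diagonal fun x : Fin 2 × d => if x.1 = i then f x.2 else 0)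
      = Matrix.single i i (1 : ℂ) ⊗ₖ diagonal f := by
    rw [← diagonal_single, diagonal_kronecker_diagonal]
    congr 1
    ext x
    by_cases hx : x.1 = i
    · simp [hx]
    · simp [hx]
  rw [spectralOp, spectralOp, h, conjTranspose_kronecker, ← mul_kronecker_mul, ← mul_kronecker_mul,
    one_mul, conjTranspose_one, mul_one]

/-- All controlled functions of `ρ` are diagonal in the common basis `1 ⊗ Q`, so comparing two of
them, or their powers, is a scalar problem. -/
lemma controlled_spectralOp {Q : Matrix d d ℂ} (hQ' : Q * Qᴴ = 1) (f : d → ℂ) :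
    controlled (spectralOp Q f)
      = spectralOp ((1 : Matrix (Fin 2) (Fin 2) ℂ) ⊗ₖ Q) fun x => if x.1 = 0 then 1 else f x.2 := by
  rw [controlled, ← spectralOp_one hQ', kronecker_spectralOp, kronecker_spectralOp, spectralOp_add]
  congr 1
  ext ⟨i, x⟩
  fin_cases i <;> simp

lemma lmrKraus_eq_controlled {d : Type} [DecidableEq d] (ρ : Matrix d d ℂ) (t : ℝ) : lmrKraus ρ t =
    controlled ((Real.cos t : ℂ) • (1 : Matrix d d ℂ) - (Complex.I * Real.sin t) • ρ) := by
  ext ⟨i, a⟩ ⟨j, b⟩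
  fin_cases i <;> fin_cases j <;>
    simp [lmrKraus, controlled, dampedControl, diagonal_apply, one_apply]

end spectral

/-! ### Scalar estimates for the eigenvalues -/

section scalar

lemma norm_pow_sub_pow_le {z w : ℂ} (hz : ‖z‖ ≤ 1) (hw : ‖w‖ ≤ 1) (n : ℕ) :
    ‖z ^ n - w ^ n‖ ≤ n * ‖z - w‖ := by
  induction n with
  | zero => simp
  | succ n ih =>
    have h : z ^ (n + 1) - w ^ (n + 1) = z ^ n * (z - w) + (z ^ n - w ^ n) * w := by ring
    have h1 : ‖z ^ n‖ ≤ 1 := by rw [norm_pow]; exact pow_le_one₀ (norm_nonneg _) hz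
    calc ‖z ^ (n + 1) - w ^ (n + 1)‖ ≤ ‖z ^ n‖ * ‖z - w‖ + ‖z ^ n - w ^ n‖ * ‖w‖ := by
          rw [h, ← norm_mul, ← norm_mul]; exact norm_add_le _ _
      _ ≤ 1 * ‖z - w‖ + n * ‖z - w‖ * 1 := by gcongr
      _ = _ := by push_cast; ring

/-- The squared modulus is `cos² t + p² sin² t`. The averaged gate is not unitary, but it is a
contraction. -/
lemma norm_cos_sub_mul_sin_le {p : ℝ} (hp0 : 0 ≤ p) (hp1 : p ≤ 1) (t : ℝ) :
    ‖(Real.cos t : ℂ) - Complex.I * Real.sin t * p‖ ≤ 1 := by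
  have h : (Real.cos t : ℂ) - Complex.I * Real.sin t * p
      = (Real.cos t : ℂ) + ((-(Real.sin t * p) : ℝ) : ℂ) * Complex.I := by push_cast; ring
  rw [h, Complex.norm_add_mul_I]
  refine Real.sqrt_le_one.mpr ?_
  have : p ^ 2 ≤ 1 := pow_le_one₀ hp0 hp1
  nlinarith [Real.cos_sq_add_sin_sq t, sq_nonneg (Real.sin t)]

/-- Both numbers are `1 - i p t` to first order; the real and imaginary parts of the difference are
each at most `t² / 2`. -/
lemma norm_cos_sub_mul_sin_sub_exp_le {p t : ℝ} (hp0 : 0 ≤ p) (hp1 : p ≤ 1) (ht0 : 0 ≤ t)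
    (ht1 : t ≤ 1) :
    ‖((Real.cos t : ℂ) - Complex.I * Real.sin t * p) - Complex.exp (-Complex.I * (p * t))‖
      ≤ t ^ 2 := by
  have h : ((Real.cos t : ℂ) - Complex.I * Real.sin t * p) - Complex.exp (-Complex.I * (p * t))
      = ((Real.cos t - Real.cos (p * t) : ℝ) : ℂ)
        + ((Real.sin (p * t) - p * Real.sin t : ℝ) : ℂ) * Complex.I := by
    have : -Complex.I * (p * t) = (-(p * t) : ℂ) * Complex.I := by ring
    rw [this, Complex.exp_mul_I, Complex.cos_neg, Complex.sin_neg]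
    push_cast
    ring
  have hpt : p * t ≤ t := by nlinarith
  have hpt0 : 0 ≤ p * t := by positivity
  have hc1 : |Real.cos t - Real.cos (p * t)| ≤ t ^ 2 / 2 := by
    have h1 := Real.one_sub_sq_div_two_le_cos (x := t)
    have h2 := Real.one_sub_sq_div_two_le_cos (x := p * t)
    have h3 := Real.cos_le_one t
    have h4 := Real.cos_le_one (p * t)
    have h5 : (p * t) ^ 2 ≤ t ^ 2 := by gcongr
    rw [abs_le]
    constructor <;> linarith
  have hcube : ∀ x : ℝ, 0 ≤ x → x ≤ 1 → x - x ^ 2 / 6 ≤ Real.sin x := by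
    intro x hx hx1
    rcases hx.eq_or_lt with rfl | hx
    · simp
    · have := Real.sin_gt_sub_cube hx
      nlinarith [sq_nonneg x]
  have hs1 : |Real.sin (p * t) - p * Real.sin t| ≤ t ^ 2 / 2 := by
    have h1 := hcube t ht0 ht1
    have h2 := hcube (p * t) hpt0 (hpt.trans ht1)
    have h3 := Real.sin_le ht0
    have h4 := Real.sin_le hpt0
    have h5 : (p * t) ^ 2 ≤ t ^ 2 := by gcongr
    have h6 := mul_le_mul_of_nonneg_left h1 hp0
    have h7 := mul_le_mul_of_nonneg_left h3 hp0
    have h8 : p * t ^ 2 ≤ t ^ 2 := by nlinarith [sq_nonneg t]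
    rw [abs_le]
    constructor <;> nlinarith
  rw [h]
  refine (norm_add_le _ _).trans ?_
  rw [norm_mul, Complex.norm_I, mul_one, Complex.norm_real, Complex.norm_real, Real.norm_eq_abs,
    Real.norm_eq_abs]
  linarith

end scalar

/-! ### Error of density matrix exponentiation -/

section error
variable {d : Type} [Fintype d] [DecidableEq d]

lemma one_kronecker_conjTranspose_mul {Q : Matrix d d ℂ} (hQ : Qᴴ * Q = 1) :
    ((1 : Matrix (Fin 2) (Fin 2) ℂ) ⊗ₖ Q)ᴴ * ((1 : Matrix (Fin 2) (Fin 2) ℂ) ⊗ₖ Q) = 1 := by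
  rw [conjTranspose_kronecker, ← mul_kronecker_mul, hQ, conjTranspose_one, one_mul,
    one_kronecker_one]

lemma one_kronecker_mul_conjTranspose {Q : Matrix d d ℂ} (hQ : Q * Qᴴ = 1) :
    ((1 : Matrix (Fin 2) (Fin 2) ℂ) ⊗ₖ Q) * ((1 : Matrix (Fin 2) (Fin 2) ℂ) ⊗ₖ Q)ᴴ = 1 := by
  rw [conjTranspose_kronecker, ← mul_kronecker_mul, hQ, conjTranspose_one, one_mul,
    one_kronecker_one]

lemma TraceLE.conjBy_ctrlSwap : TraceLE (SamplePhaseEstimation.conjBy (ctrlSwap d)) 1 := by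
  refine TraceLE.conjBy ?_
  rw [ctrlSwap_conjTranspose, ctrlSwap_mul_self, Complex.ofReal_one, one_smul, ← diagonal_one,
    diagonal_sub]
  refine PosSemidef.diagonal fun p => ?_
  dsimp only [Pi.zero_apply]
  split_ifs <;> simp

/-- The operation performed by one step of density matrix exponentiation. -/
def lmrOp (ρ : Matrix d d ℂ) (t : ℝ) : SuperOp (Fin 2 × d) (Fin 2 × d) :=
  lmrStep d t ∘ₗ appendState ρ

lemma IsCP.lmrOp {ρ : Matrix d d ℂ} (hρ : IsDensity ρ) (t : ℝ) : IsCP (lmrOp ρ t) :=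
  (IsCP.lmrStep t).comp (IsCP.appendState hρ.1)

lemma IsTP.lmrOp {ρ : Matrix d d ℂ} (hρ : IsDensity ρ) (t : ℝ) : IsTP (lmrOp ρ t) :=
  (IsTP.lmrStep t).comp (IsTP.appendState hρ.2)

lemma TraceLE.conjBy_controlled_spectralOp {Q : Matrix d d ℂ} (hQ : Qᴴ * Q = 1)
    (hQ' : Q * Qᴴ = 1) {f : d → ℂ} (hf : ∀ i, ‖f i‖ ≤ 1) :
    TraceLE (SamplePhaseEstimation.conjBy (controlled (spectralOp Q f))) 1 := by
  rw [controlled_spectralOp hQ']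
  refine TraceLE.conjBy_spectralOp (one_kronecker_conjTranspose_mul hQ)
    (one_kronecker_mul_conjTranspose hQ') fun i => ?_
  split_ifs
  · simp
  · exact pow_le_one₀ (norm_nonneg _) (hf _)

/-- The two quadratic terms of `lmrStep_kronecker` serve as the positive parts. Each has weight
`sin² t` and a conjugation by a contraction, the restricted swap or `ρ` on control `1`. -/
lemma close_lmrOp {ρ : Matrix d d ℂ} (hρ : IsDensity ρ) (t : ℝ) :
    Close (lmrOp ρ t) (conjBy (lmrKraus ρ t)) (2 * Real.sin t ^ 2) := by
  obtain ⟨Q, p, hQ, hQ', hp0, hp1, hρQ⟩ := exists_spectralOp_of_isDensity hρ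
  refine ⟨((Real.sin t ^ 2 : ℝ) : ℂ) • (partialTrace ∘ₗ conjBy (ctrlSwap d) ∘ₗ appendState ρ),
    ((Real.sin t ^ 2 : ℝ) : ℂ) • conjBy (Matrix.single (1 : Fin 2) (1 : Fin 2) (1 : ℂ) ⊗ₖ ρ),
    (IsCP.partialTrace.comp ((IsCP.conjBy _).comp (IsCP.appendState hρ.1))).smul (by positivity),
    (IsCP.conjBy _).smul (by positivity), ?_, fun X hX => ?_⟩
  · refine LinearMap.ext fun X => ?_
    change lmrStep d t (X ⊗ₖ ρ) - _ = _
    rw [lmrStep_kronecker hρ, add_sub_assoc, add_sub_cancel_left]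
    rfl
  · have h1 : (partialTrace (conjBy (ctrlSwap d) (X ⊗ₖ ρ))).trace.re ≤ 1 * X.trace.re := by
      have h := TraceLE.conjBy_ctrlSwap (X ⊗ₖ ρ) (hX.kronecker hρ.1)
      rw [trace_kronecker, hρ.2, mul_one] at h
      rwa [IsTP.partialTrace]
    have h2 : (conjBy (Matrix.single (1 : Fin 2) (1 : Fin 2) (1 : ℂ) ⊗ₖ ρ) X).trace.re
        ≤ 1 * X.trace.re := by
      rw [hρQ, kronecker_spectralOp]
      refine TraceLE.conjBy_spectralOp (one_kronecker_conjTranspose_mul hQ)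
        (one_kronecker_mul_conjTranspose hQ') (fun i => ?_) X hX
      split_ifs
      · rw [Complex.norm_real, Real.norm_eq_abs, sq_abs]
        exact pow_le_one₀ (hp0 _) (hp1 _)
      · simp
    rw [LinearMap.add_apply, trace_add, LinearMap.smul_apply, LinearMap.smul_apply, trace_smul,
      trace_smul, Complex.add_re, smul_eq_mul, smul_eq_mul, Complex.re_ofReal_mul,
      Complex.re_ofReal_mul]
    have h3 := mul_le_mul_of_nonneg_left (add_le_add h1 h2) (sq_nonneg (Real.sin t))
    simp only [LinearMap.comp_apply]
    change _ * (partialTrace (conjBy (ctrlSwap d) (X ⊗ₖ ρ))).trace.re + _ ≤ _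
    linarith

/-- Density matrix exponentiation with `r` copies performs the controlled `exp (-i ρ)` up to an
error inversely proportional to `r`. -/
lemma close_withCopies_lmr {ρ : Matrix d d ℂ} (hρ : IsDensity ρ) {r : ℕ} (hr : 0 < r) :
    Close (withCopies r (lmr d (1 / r) r) ρ)
      (conjBy (controlled (NormedSpace.exp ((-Complex.I) • ρ)))) (4 / r) := by
  obtain ⟨Q, p, hQ, hQ', hp0, hp1, hρQ⟩ := exists_spectralOp_of_isDensity hρ
  have hr0 : (0 : ℝ) < r := by exact_mod_cast hr
  have hr1 : (1 : ℝ) ≤ r := by exact_mod_cast hr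
  set t : ℝ := 1 / r with ht
  have ht0 : 0 < t := by positivity
  have ht1 : t ≤ 1 := by rw [ht, div_le_one hr0]; exact hr1
  have hR := one_kronecker_conjTranspose_mul hQ
  have hR' := one_kronecker_mul_conjTranspose hQ'
  set z : d → ℂ := fun i => (Real.cos t : ℂ) - Complex.I * Real.sin t * p i with hz
  have hz1 : ∀ i, ‖z i‖ ≤ 1 := fun i => norm_cos_sub_mul_sin_le (hp0 i) (hp1 i) t
  have hK : lmrKraus ρ t = controlled (spectralOp Q z) := by
    rw [lmrKraus_eq_controlled, hρQ, ← spectralOp_one hQ', spectralOp_smul, spectralOp_smul,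
      spectralOp_sub]
    congr 2
    ext i
    simp [hz]
  have hexp : NormedSpace.exp ((-Complex.I) • ρ)
      = spectralOp Q fun i => Complex.exp (-Complex.I * p i) := by
    rw [hρQ, spectralOp_smul, exp_spectralOp hQ']
    rfl
  have hw : ∀ i, ‖Complex.exp (-Complex.I * (p i * t))‖ ≤ 1 := fun i => by
    have : -Complex.I * (p i * t) = ((-(p i * t) : ℝ) : ℂ) * Complex.I := by push_cast; ring
    rw [this, Complex.norm_exp_ofReal_mul_I]
  have hw1 : ∀ i, ‖Complex.exp (-Complex.I * p i)‖ ≤ 1 := fun i => by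
    have : -Complex.I * p i = ((-(p i) : ℝ) : ℂ) * Complex.I := by push_cast; ring
    rw [this, Complex.norm_exp_ofReal_mul_I]
  have hKt : TraceLE (conjBy (lmrKraus ρ t)) 1 := by
    rw [hK]; exact TraceLE.conjBy_controlled_spectralOp hQ hQ' hz1
  have hpow : lmrKraus ρ t ^ r = controlled (spectralOp Q (z ^ r)) := by
    rw [hK, controlled_spectralOp hQ', spectralOp_pow hR hR', controlled_spectralOp hQ']
    congr 1
    ext ⟨i, x⟩
    by_cases hi : i = 0 <;> simp [hi]
  -- Replacing the `r` steps one at a time costs `r · 2 sin² t ≤ 2 / r`.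
  have h1 : Close (withCopies r (lmr d t r) ρ) (conjBy (lmrKraus ρ t ^ r)) (2 / r) := by
    have h := Close.list_prod (by positivity) (fun _ : Unit => close_lmrOp hρ t)
      (fun _ => IsCP.lmrOp hρ t) (fun _ => (IsTP.lmrOp hρ t).traceLE) (fun _ => IsCP.conjBy _)
      (fun _ => hKt) (List.replicate r ())
    rw [List.map_replicate, List.map_replicate, List.prod_replicate, List.prod_replicate,
      List.length_replicate, conjBy_pow] at h
    rw [withCopies_lmr]
    refine h.mono ?_
    have hs : Real.sin t ^ 2 ≤ t ^ 2 := by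
      have := Real.abs_sin_le_abs (x := t)
      exact sq_le_sq.mpr this
    calc (r : ℝ) * (2 * Real.sin t ^ 2) ≤ (r : ℝ) * (2 * t ^ 2) := by gcongr
      _ = 2 / (r : ℝ) := by rw [ht]; field_simp
  have h2 : Close (conjBy (lmrKraus ρ t ^ r))
      (conjBy (controlled (NormedSpace.exp ((-Complex.I) • ρ)))) (2 * t) := by
    rw [hpow, hexp]
    refine Close.conjBy ht0 (TraceLE.conjBy_controlled_spectralOp hQ hQ' fun i => ?_)
      (TraceLE.conjBy_controlled_spectralOp hQ hQ' hw1) ?_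
    · rw [Pi.pow_apply, norm_pow]
      exact pow_le_one₀ (norm_nonneg _) (hz1 i)
    · rw [controlled_spectralOp hQ', controlled_spectralOp hQ', spectralOp_sub]
      refine TraceLE.conjBy_spectralOp hR hR' fun i => ?_
      by_cases hi : i.1 = 0
      · simp [hi, sq_nonneg]
      · simp only [Pi.sub_apply, hi, if_false, Pi.pow_apply]
        -- Since `r t = 1`, the target eigenvalue is an `r`-th power as well. An error of `t²` per
        -- factor becomes `r t² = t`.
        have he : Complex.exp (-Complex.I * p i.2)
            = Complex.exp (-Complex.I * (p i.2 * t)) ^ r := by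
          rw [← Complex.exp_nat_mul]
          congr 1
          rw [ht]
          push_cast
          have : (r : ℂ) ≠ 0 := by exact_mod_cast hr.ne'
          field_simp
        rw [he]
        have h3 : ‖z i.2 ^ r - Complex.exp (-Complex.I * (p i.2 * t)) ^ r‖ ≤ t := by
          calc _ ≤ r * ‖z i.2 - Complex.exp (-Complex.I * (p i.2 * t))‖ :=
                norm_pow_sub_pow_le (hz1 _) (hw _) r
            _ ≤ r * t ^ 2 := by
                gcongr
                exact norm_cos_sub_mul_sin_sub_exp_le (hp0 _) (hp1 _) ht0.le ht1
            _ = t := by rw [ht]; field_simp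
        gcongr
  exact (h1.trans h2).mono (by rw [ht]; apply le_of_eq; ring)

lemma TraceLE.conjBy_controlled_exp {ρ : Matrix d d ℂ} (hρ : IsDensity ρ) :
    TraceLE (SamplePhaseEstimation.conjBy (controlled (NormedSpace.exp ((-Complex.I) • ρ)))) 1 := by
  obtain ⟨Q, p, hQ, hQ', -, -, hρQ⟩ := exists_spectralOp_of_isDensity hρ
  rw [hρQ, spectralOp_smul, exp_spectralOp hQ']
  refine TraceLE.conjBy_controlled_spectralOp hQ hQ' fun i => ?_
  have : ((-Complex.I) • fun i => (p i : ℂ)) i = ((-(p i) : ℝ) : ℂ) * Complex.I := by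
    simp [mul_comm]
  rw [this, Complex.norm_exp_ofReal_mul_I]

lemma IsCP.withCopies_lmr {ρ : Matrix d d ℂ} (hρ : IsDensity ρ) (t : ℝ) (r : ℕ) :
    IsCP (withCopies r (SamplePhaseEstimation.lmr d t r) ρ) := by
  rw [SamplePhaseEstimation.withCopies_lmr, ← List.prod_replicate]
  refine IsCP.list_prod fun Φ hΦ => ?_
  rw [List.eq_of_mem_replicate hΦ]
  exact IsCP.lmrOp hρ t

lemma TraceLE.withCopies_lmr {ρ : Matrix d d ℂ} (hρ : IsDensity ρ) (t : ℝ) (r : ℕ) :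
    TraceLE (withCopies r (lmr d t r) ρ) 1 := by
  rw [SamplePhaseEstimation.withCopies_lmr, ← List.prod_replicate]
  refine TraceLE.list_prod (fun Φ hΦ => ?_) fun Φ hΦ => ?_
  · rw [List.eq_of_mem_replicate hΦ]
    exact IsCP.lmrOp hρ t
  · rw [List.eq_of_mem_replicate hΦ]
    exact (IsTP.lmrOp hρ t).traceLE

/-- The phases of the eigenvalues of `exp (-i ρ)` lie in `[-1, 0]`. -/
lemma phase_mem_Icc {ρ : Matrix d d ℂ} (hρ : IsDensity ρ) {θ : ℝ} {v : d → ℂ}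
    (hθ : θ ∈ Set.Ioc (-Real.pi) Real.pi) (hv : star v ⬝ᵥ v = 1)
    (h : NormedSpace.exp ((-Complex.I) • ρ) *ᵥ v = Complex.exp (θ * Complex.I) • v) :
    θ ∈ Set.Icc (-1) 0 := by
  obtain ⟨Q, p, hQ, hQ', hp0, hp1, hρQ⟩ := exists_spectralOp_of_isDensity hρ
  rw [hρQ, spectralOp_smul, exp_spectralOp hQ', spectralOp] at h
  -- A nonzero vector has a nonzero coordinate in the eigenbasis of `ρ`; comparing that coordinate
  -- gives `exp(-i p i) = exp(i θ)`.
  have hw : ∃ i, (Qᴴ *ᵥ v) i ≠ 0 := by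
    by_contra! hcon
    have h0 : Qᴴ *ᵥ v = 0 := funext hcon
    have h1 : v = 0 := by
      rw [← one_mulVec v, ← hQ', ← mulVec_mulVec, h0, mulVec_zero]
    simp [h1] at hv
  obtain ⟨i, hi⟩ := hw
  have h1 := congrFun (congrArg (fun w => Qᴴ *ᵥ w) h) i
  simp only [mulVec_mulVec, mulVec_smul] at h1
  rw [Matrix.mul_assoc, ← Matrix.mul_assoc, hQ, Matrix.one_mul, ← mulVec_mulVec, mulVec_diagonal,
    Pi.smul_apply, smul_eq_mul] at h1
  have h2 := mul_right_cancel₀ hi h1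
  have h3 : ((-Complex.I) • fun i => (p i : ℂ)) i = ((-(p i) : ℝ) : ℂ) * Complex.I := by
    simp [mul_comm]
  rw [Pi.smul_apply, smul_eq_mul] at h3
  rw [h3] at h2
  have hpi := Real.pi_gt_three
  -- Both `-p i` and `θ` lie in the principal range, so equal exponentials force equal phases.
  have h4 := congrArg Complex.arg h2
  have h5 : -(p i) ∈ Set.Ioc (-Real.pi) Real.pi :=
    ⟨by linarith [hp1 i], by linarith [hp0 i]⟩
  rw [Complex.arg_exp_mul_I, Complex.arg_exp_mul_I,
    (toIocMod_eq_self Real.two_pi_pos).mpr ⟨h5.1, by linarith [h5.2]⟩,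
    (toIocMod_eq_self Real.two_pi_pos).mpr ⟨hθ.1, by linarith [hθ.2]⟩] at h4
  rw [← h4]
  exact ⟨by linarith [hp1 i], by linarith [hp0 i]⟩

end error

/-! ### Phase kickback and the exact outcome distribution -/

section pure
variable {d : Type} [Fintype d] [DecidableEq d] {m : ℕ}

/-- The rank one operator `|u⟩⟨u|`. -/
def pureState {a : Type*} (u : a → ℂ) : Matrix a a ℂ := vecMulVec u (star u)

/-- The product of a register state and a target state. -/
def prodVec (g : Reg m → ℂ) (v : d → ℂ) : Reg m × d → ℂ := fun p => g p.1 * v p.2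

lemma conjBy_pureState {a b : Type} [Fintype a] (W : Matrix b a ℂ) (u : a → ℂ) :
    conjBy W (pureState u) = pureState (W *ᵥ u) := by
  rw [conjBy_apply, pureState, pureState, mul_vecMulVec, vecMulVec_mul, star_mulVec]

lemma kronecker_one_mulVec_prodVec (A : Matrix (Reg m) (Reg m) ℂ) (g : Reg m → ℂ) (v : d → ℂ) :
    (A ⊗ₖ (1 : Matrix d d ℂ)) *ᵥ prodVec g v = prodVec (A *ᵥ g) v := by
  ext ⟨x, a⟩
  simp only [mulVec, dotProduct, Fintype.sum_prod_type, kroneckerMap_apply, prodVec,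
    Finset.sum_mul]
  refine Finset.sum_congr rfl fun y _ => ?_
  rw [Finset.sum_eq_single a]
  · simp [mul_assoc]
  · intro b _ hb
    simp [one_apply, hb.symm]
  · simp

lemma initRegister_pureState {d : Type} (v : d → ℂ) :
    initRegister m d (pureState v) = pureState (prodVec (Pi.single 0 1) v) := by
  ext ⟨x, a⟩ ⟨y, b⟩
  change Matrix.single (0 : Reg m) (0 : Reg m) (1 : ℂ) x y * pureState v a b = _
  by_cases hx : x = 0 <;> by_cases hy : y = 0 <;>
    simp [pureState, vecMulVec_apply, prodVec, hx, hy, eq_comm]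

lemma controlled_mulVec {U : Matrix d d ℂ} (u : Fin 2 × d → ℂ) (i : Fin 2) (a : d) :
    (controlled U *ᵥ u) (i, a) = if i = 0 then u (0, a) else (U *ᵥ fun b => u (1, b)) a := by
  simp only [controlled, add_mulVec, Pi.add_apply]
  fin_cases i <;> simp [mulVec, dotProduct, Fintype.sum_prod_type, one_apply]

/-- A controlled gate acting on an eigenvector kicks the phase back to the control qubit. -/
lemma onQubit_controlled_pureState {U : Matrix d d ℂ} {v : d → ℂ} {z : ℂ} (h : U *ᵥ v = z • v)
    (j : Fin m) (g : Reg m → ℂ) :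
    onQubit j (conjBy (controlled U)) (pureState (prodVec g v))
      = pureState (prodVec (fun x => z ^ (x j : ℕ) * g x) v) := by
  have hslice : ∀ p : Reg m × d, (controlled U *ᵥ fun c : Fin 2 × d =>
      prodVec g v (Function.update p.1 j c.1, c.2)) (p.1 j, p.2)
      = prodVec (fun x => z ^ (x j : ℕ) * g x) v p := by
    rintro ⟨x, a⟩
    rw [controlled_mulVec]
    have hU : ∀ s : ℂ, (U *ᵥ fun b => s * v b) a = s * (z * v a) := by
      intro s
      have : (fun b => s * v b) = s • v := rfl
      rw [this, mulVec_smul, h]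
      rfl
    simp only [prodVec, hU]
    have hx : x j = 0 ∨ x j = 1 := by
      generalize x j = i
      fin_cases i <;> simp
    rcases hx with hx | hx
    · have : Function.update x j 0 = x := by rw [← hx, Function.update_eq_self]
      simp [hx, this]
    · have : Function.update x j 1 = x := by rw [← hx, Function.update_eq_self]
      simp only [hx, this]
      simp
      ring
  ext p q
  have h1 : onQubit j (conjBy (controlled U)) (pureState (prodVec g v)) p q
      = (controlled U * vecMulVec (fun c : Fin 2 × d =>
        prodVec g v (Function.update p.1 j c.1, c.2)) (star fun c : Fin 2 × d =>
        prodVec g v (Function.update q.1 j c.1, c.2)) * (controlled U)ᴴ) (p.1 j, p.2)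
          (q.1 j, q.2) := rfl
  rw [h1, mul_vecMulVec, vecMulVec_mul, ← star_mulVec, vecMulVec_apply, hslice, Pi.star_apply,
    hslice]
  rfl

lemma onQubit_prod_pureState {U : Matrix d d ℂ} {v : d → ℂ} {z : ℂ} (h : U *ᵥ v = z • v)
    (l : List (Fin m)) (g : Reg m → ℂ) :
    (l.map fun j => (onQubit j (conjBy (controlled U)) :
        Module.End ℂ (Matrix (Reg m × d) (Reg m × d) ℂ))).prod (pureState (prodVec g v))
      = pureState (prodVec (fun x => z ^ (l.map fun j => (x j : ℕ)).sum * g x) v) := by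
  induction l generalizing g with
  | nil => simp
  | cons j l ih =>
    rw [List.map_cons, List.prod_cons, Module.End.mul_apply, ih, onQubit_controlled_pureState h]
    congr 2
    ext x
    rw [List.map_cons, List.sum_cons, pow_add, mul_assoc]

/-- Qubit `j` occurs `2^j` times, so the kicked-back exponents add up to the integer whose binary
digits are `x`. -/
lemma sum_controlSchedule (x : Reg m) :
    ((controlSchedule m).map fun j => (x j : ℕ)).sum = regVal x := by
  rw [controlSchedule, List.map_flatMap, List.flatMap_def, List.sum_flatten, List.map_map, regVal, Fin.sum_univ_def]
  congr 1
  refine List.map_congr_left fun j _ => ?_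
  simp [mul_comm]

lemma tensorPower_hadamard_mulVec (x : Reg m) :
    (tensorPower hadamard m *ᵥ Pi.single 0 1) x = (((Real.sqrt (2 ^ m))⁻¹ : ℝ) : ℂ) := by
  rw [mulVec_single_one, col_apply]
  have h : ∀ i : Fin 2, hadamard i 0 = (((Real.sqrt 2)⁻¹ : ℝ) : ℂ) := by
    intro i; fin_cases i <;> simp [hadamard]
  simp only [tensorPower, of_apply, Pi.zero_apply, h]
  rw [Finset.prod_const, Finset.card_univ, Fintype.card_fin, ← Complex.ofReal_pow, inv_pow]
  congr 2
  rw [Real.sqrt_eq_rpow, Real.sqrt_eq_rpow, ← Real.rpow_natCast, ← Real.rpow_natCast,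
    ← Real.rpow_mul (by norm_num), ← Real.rpow_mul (by norm_num), mul_comm]

/-- The phase seen by the outcome `k` of phase estimation with eigenvalue `exp (i θ)`. -/
def outcomePhase (m : ℕ) (θ : ℝ) (k : ℕ) : ℂ :=
  Complex.exp (((θ - 2 * Real.pi * k / 2 ^ m : ℝ) : ℂ) * Complex.I)

lemma qft_conjTranspose_mulVec (θ : ℝ) (x : Reg m) :
    ((qft m)ᴴ *ᵥ fun y => Complex.exp (θ * Complex.I) ^ regVal y *
      (((Real.sqrt (2 ^ m))⁻¹ : ℝ) : ℂ)) x
      = ((2 : ℂ) ^ m)⁻¹ * ∑ n ∈ Finset.range (2 ^ m), outcomePhase m θ (regVal x) ^ n := by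
  have h1 : (((Real.sqrt (2 ^ m))⁻¹ : ℝ) : ℂ) * (((Real.sqrt (2 ^ m))⁻¹ : ℝ) : ℂ)
      = ((2 : ℂ) ^ m)⁻¹ := by
    rw [← Complex.ofReal_mul, ← mul_inv, Real.mul_self_sqrt (by positivity)]; push_cast; rfl
  rw [← sum_reg m fun n => outcomePhase m θ (regVal x) ^ n, Finset.mul_sum]
  refine Finset.sum_congr rfl fun y _ => ?_
  change star (qft m y x) * (_ * _) = _
  rw [← h1]
  simp only [qft, of_apply, star_mul', Complex.star_def, Complex.conj_ofReal, ← Complex.exp_conj,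
    outcomePhase, ← Complex.exp_nat_mul]
  rw [mul_comm (Complex.exp (_ * _)), mul_mul_mul_comm, ← Complex.exp_add]
  congr 2
  simp only [map_div₀, map_mul, map_ofNat, Complex.conj_ofReal, Complex.conj_I, map_natCast,
    map_pow]
  push_cast
  ring

lemma outcomeProb_measureRegister_pureState {d : Type} [Fintype d] {v : d → ℂ} (hv : star v ⬝ᵥ v = 1) (g : Reg m → ℂ)
    (x : Reg m) : outcomeProb (measureRegister m d (pureState (prodVec g v))) x = ‖g x‖ ^ 2 := by
  have h1 : ∀ a, ((measureRegister m d (pureState (prodVec g v))) (x, a) (x, a)).re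
      = ‖g x‖ ^ 2 * ‖v a‖ ^ 2 := by
    intro a
    simp only [measureRegister, pureState, prodVec, LinearMap.coe_mk, AddHom.coe_mk, of_apply,
      if_true, vecMulVec_apply, Pi.star_apply, Complex.star_def, Complex.mul_conj']
    rw [norm_mul, ← Complex.ofReal_pow, Complex.ofReal_re, mul_pow]
  have h2 : ∑ a, ‖v a‖ ^ 2 = 1 := by
    have h3 : ∀ a, (star v) a * v a = ((‖v a‖ ^ 2 : ℝ) : ℂ) := fun a => by
      rw [Pi.star_apply, Complex.star_def, Complex.conj_mul']; push_cast; rfl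
    rw [dotProduct, Finset.sum_congr rfl fun a _ => h3 a] at hv
    exact_mod_cast hv
  rw [outcomeProb, Finset.sum_congr rfl fun a _ => h1 a, ← Finset.mul_sum, h2, mul_one]

/-- The outcome distribution of phase estimation on an eigenvector. -/
lemma outcomeProb_kitaev {U : Matrix d d ℂ} {v : d → ℂ} {θ : ℝ} (hv : star v ⬝ᵥ v = 1)
    (h : U *ᵥ v = Complex.exp (θ * Complex.I) • v) (x : Reg m) :
    outcomeProb (kitaev m U (vecMulVec v (star v))) x
      = ‖((2 : ℂ) ^ m)⁻¹ * ∑ n ∈ Finset.range (2 ^ m), outcomePhase m θ (regVal x) ^ n‖ ^ 2 := by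
  rw [← qft_conjTranspose_mulVec, kitaev, phaseEstimation]
  simp only [LinearMap.comp_apply]
  have h0 : vecMulVec v (star v) = pureState v := rfl
  rw [h0, initRegister_pureState, conjBy_pureState, kronecker_one_mulVec_prodVec,
    onQubit_prod_pureState h, conjBy_pureState, kronecker_one_mulVec_prodVec,
    outcomeProb_measureRegister_pureState hv]
  simp only [sum_controlSchedule, tensorPower_hadamard_mulVec]

end pure

/-! ### Tail bound for the outcome distribution -/

section tail

lemma norm_outcomePhase (m : ℕ) (θ : ℝ) (k : ℕ) : ‖outcomePhase m θ k‖ = 1 :=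
  Complex.norm_exp_ofReal_mul_I _

/-- Parseval's identity for truncated geometric sums. -/
lemma sum_norm_geom_sq (m : ℕ) (θ : ℝ) {L : ℕ} (hL : L ≤ 2 ^ m) :
    ∑ x : Reg m, ‖∑ n ∈ Finset.range L, outcomePhase m θ (regVal x) ^ n‖ ^ 2 = 2 ^ m * L := by
  have h1 : ∀ k : ℕ, ((‖∑ n ∈ Finset.range L, outcomePhase m θ k ^ n‖ ^ 2 : ℝ) : ℂ)
      = ∑ n ∈ Finset.range L, ∑ n' ∈ Finset.range L,
        Complex.exp ((θ * (n - n') : ℝ) * Complex.I) *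
        Complex.exp (2 * Real.pi * Complex.I * (((n' - n : ℤ) : ℂ) / ((2 ^ m : ℕ) : ℂ))) ^ k := by
    intro k
    push_cast
    rw [← Complex.mul_conj', map_sum, Finset.sum_mul_sum]
    refine Finset.sum_congr rfl fun n _ => Finset.sum_congr rfl fun n' _ => ?_
    rw [map_pow, outcomePhase, ← Complex.exp_conj, ← Complex.exp_nat_mul, ← Complex.exp_nat_mul,
      ← Complex.exp_nat_mul, ← Complex.exp_add, ← Complex.exp_add]
    congr 1
    simp only [map_mul, Complex.conj_ofReal, Complex.conj_I]
    push_cast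
    ring
  have h2 : ((∑ x : Reg m, ‖∑ n ∈ Finset.range L, outcomePhase m θ (regVal x) ^ n‖ ^ 2 : ℝ) : ℂ)
      = 2 ^ m * L := by
    rw [sum_reg m fun k => ‖∑ n ∈ Finset.range L, outcomePhase m θ k ^ n‖ ^ 2,
      Complex.ofReal_sum, Finset.sum_congr rfl fun k _ => h1 k, Finset.sum_comm]
    -- Only the diagonal `n' = n` survives: frequencies below `L ≤ 2^m` are distinct modulo `2^m`.
    have h3 : ∀ n ∈ Finset.range L, ∑ k ∈ Finset.range (2 ^ m), ∑ n' ∈ Finset.range L,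
        Complex.exp ((θ * (n - n') : ℝ) * Complex.I) *
        Complex.exp (2 * Real.pi * Complex.I * (((n' - n : ℤ) : ℂ) / ((2 ^ m : ℕ) : ℂ))) ^ k
        = 2 ^ m := by
      intro n hn
      rw [Finset.sum_comm, Finset.sum_eq_single n]
      · simp
      · intro n' hn' hne
        rw [← Finset.mul_sum, sum_exp_pow (by positivity), if_neg (by omega), mul_zero]
        rw [Finset.mem_range] at hn hn'
        rw [abs_lt]
        constructor <;> omega
      · exact fun h => absurd hn h
    rw [Finset.sum_congr rfl h3, Finset.sum_const, Finset.card_range, nsmul_eq_mul, mul_comm]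
  exact_mod_cast h2

lemma norm_sub_one_mul_geom_le {z : ℂ} (hz : ‖z‖ = 1) (n : ℕ) :
    ‖1 - z‖ * ‖∑ k ∈ Finset.range n, z ^ k‖ ≤ 2 := by
  rw [← norm_mul, mul_neg_geom_sum]
  refine (norm_sub_le _ _).trans ?_
  rw [norm_one, norm_pow, hz, one_pow]
  norm_num

/-- Each summand is `|1 - z^n|² = 2 - 2 Re z^n`, and `∑ z^n` has modulus at most `2 / τ ≤ N / 2`, so
the summands average at least `1`. This bounds `|1 - z|⁻²` by a mean of squared geometric sums,
which Parseval can sum over outcomes. -/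
lemma le_sum_norm_geom_sq {z : ℂ} (hz : ‖z‖ = 1) {τ : ℝ} (hτ : τ ≤ ‖1 - z‖) {N : ℕ}
    (hN : 4 ≤ N * τ) : (N : ℝ) ≤ ‖1 - z‖ ^ 2 * ∑ n ∈ Finset.range N,
      ‖∑ k ∈ Finset.range n, z ^ k‖ ^ 2 := by
  have h1 : ∀ n : ℕ, ‖1 - z‖ ^ 2 * ‖∑ k ∈ Finset.range n, z ^ k‖ ^ 2 = 2 - 2 * (z ^ n).re := by
    intro n
    rw [← mul_pow, ← norm_mul, mul_neg_geom_sum, ← Complex.normSq_eq_norm_sq, Complex.normSq_sub,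
      Complex.normSq_eq_norm_sq, Complex.normSq_eq_norm_sq, norm_pow, hz]
    simp only [norm_one, one_pow, one_mul, Complex.conj_re]
    ring
  rw [Finset.mul_sum, Finset.sum_congr rfl fun n _ => h1 n, Finset.sum_sub_distrib,
    Finset.sum_const, Finset.card_range, nsmul_eq_mul, ← Finset.mul_sum, ← Complex.re_sum]
  have h2 := (Complex.re_le_norm (∑ n ∈ Finset.range N, z ^ n))
  have h3 := norm_sub_one_mul_geom_le hz N
  set S := ‖∑ n ∈ Finset.range N, z ^ n‖
  have hS : 0 ≤ S := norm_nonneg _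
  have h4 : τ * S ≤ 2 := (mul_le_mul_of_nonneg_right hτ hS).trans h3
  have hN0 : (0 : ℝ) ≤ N := by positivity
  have h5 : 2 * S ≤ N := by nlinarith
  linarith

/-- The outcomes whose phase is far from that of the eigenvalue are unlikely. -/
lemma sum_outcome_tail_le (m : ℕ) (θ : ℝ) {τ : ℝ} (hτ : 0 < τ) {N : ℕ} (hN : 4 ≤ N * τ)
    (hNm : N ≤ 2 ^ m) (s : Finset (Reg m))
    (hs : ∀ x ∈ s, τ ≤ ‖1 - outcomePhase m θ (regVal x)‖) :
    ∑ x ∈ s, ‖((2 : ℂ) ^ m)⁻¹ * ∑ n ∈ Finset.range (2 ^ m), outcomePhase m θ (regVal x) ^ n‖ ^ 2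
      ≤ 4 * N / 2 ^ m := by
  set M : ℝ := 2 ^ m with hM
  have hM0 : 0 < M := by positivity
  have hN0 : (0 : ℝ) < N := by
    by_contra! h
    nlinarith
  set F : Reg m → ℝ := fun x => ∑ n ∈ Finset.range N,
    ‖∑ k ∈ Finset.range n, outcomePhase m θ (regVal x) ^ k‖ ^ 2 with hF
  -- Combines `|1 - z| |∑ z^n| ≤ 2` for the full sum with the averaged bound on `|1 - z|⁻²`.
  have h1 : ∀ x ∈ s, N * ‖((2 : ℂ) ^ m)⁻¹ * ∑ n ∈ Finset.range (2 ^ m),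
      outcomePhase m θ (regVal x) ^ n‖ ^ 2 ≤ 4 / M ^ 2 * F x := by
    intro x hx
    have hz := norm_outcomePhase m θ (regVal x)
    have h2 := le_sum_norm_geom_sq hz (hs x hx) hN
    have h3 := norm_sub_one_mul_geom_le hz (2 ^ m)
    have h0 : 0 < ‖1 - outcomePhase m θ (regVal x)‖ := hτ.trans_le (hs x hx)
    set w := ‖1 - outcomePhase m θ (regVal x)‖
    rw [norm_mul, mul_pow, norm_inv, norm_pow, Complex.norm_ofNat, ← hM]
    set S := ‖∑ n ∈ Finset.range (2 ^ m), outcomePhase m θ (regVal x) ^ n‖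
    have h4 : (w * S) ^ 2 ≤ 2 ^ 2 := by gcongr
    have hFx : 0 ≤ F x := Finset.sum_nonneg fun _ _ => by positivity
    calc N * ((M⁻¹) ^ 2 * S ^ 2) ≤ (w ^ 2 * F x) * ((M⁻¹) ^ 2 * S ^ 2) := by gcongr
      _ = (w * S) ^ 2 * (F x * (M⁻¹) ^ 2) := by ring
      _ ≤ 2 ^ 2 * (F x * (M⁻¹) ^ 2) := by gcongr
      _ = 4 / M ^ 2 * F x := by ring
  -- Parseval for each truncation length `n < N`, with `n` replaced by `N`.
  have h2 : ∑ x : Reg m, F x ≤ N * (M * N) := by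
    rw [hF, Finset.sum_comm]
    calc _ ≤ ∑ n ∈ Finset.range N, M * N := by
          refine Finset.sum_le_sum fun n hn => ?_
          rw [Finset.mem_range] at hn
          rw [sum_norm_geom_sq m θ (hn.le.trans hNm)]
          gcongr
      _ = _ := by rw [Finset.sum_const, Finset.card_range, nsmul_eq_mul]
  have h3 : ∑ x ∈ s, F x ≤ ∑ x : Reg m, F x :=
    Finset.sum_le_sum_of_subset_of_nonneg (Finset.subset_univ s) fun x _ _ =>
      Finset.sum_nonneg fun _ _ => by positivity
  have h4 := Finset.sum_le_sum h1
  rw [← Finset.mul_sum, ← Finset.mul_sum] at h4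
  refine le_of_mul_le_mul_left (h4.trans ?_) hN0
  calc 4 / M ^ 2 * ∑ x ∈ s, F x ≤ 4 / M ^ 2 * (N * (M * N)) := by gcongr; exact h3.trans h2
    _ = N * (4 * N / M) := by field_simp

/-- Parseval at full length `2^m`; it lets the probability of success be read off from the tail. -/
lemma sum_outcome_eq_one (m : ℕ) (θ : ℝ) :
    ∑ x : Reg m, ‖((2 : ℂ) ^ m)⁻¹ *
      ∑ n ∈ Finset.range (2 ^ m), outcomePhase m θ (regVal x) ^ n‖ ^ 2 = 1 := by
  have h := sum_norm_geom_sq m θ (le_refl (2 ^ m))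
  simp only [norm_mul, mul_pow, norm_inv, norm_pow, Complex.norm_ofNat] at h ⊢
  rw [← Finset.mul_sum, h]
  push_cast
  field_simp

/-- The error is measured on the line but the outcome phase sees only the circle. Since `θ` lies in
`[-1, 0]`, the real difference is at most `π + 1`, so even after wrapping around the circular
distance is at least `π - 1 > ε`. -/
lemma le_norm_one_sub_outcomePhase {m : ℕ} {θ ε : ℝ} (hθ : θ ∈ Set.Icc (-1) 0) (hε : 0 < ε)
    (hε1 : ε ≤ 1) {x : Reg m} (hx : ε < |phaseEstimate x - θ|) :
    ε / 2 ≤ ‖1 - outcomePhase m θ (regVal x)‖ := by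
  set ψ := phaseEstimate x - θ with hψ
  have hpi := Real.pi_gt_three
  have hpi4 := Real.pi_le_four
  have hmem : phaseEstimate x ∈ Set.Ioc (-Real.pi) (-Real.pi + 2 * Real.pi) :=
    toIocMod_mem_Ioc Real.two_pi_pos _ _
  have hcos : Real.cos (θ - 2 * Real.pi * regVal x / 2 ^ m) = Real.cos |ψ| := by
    have h := toIocMod_add_toIocDiv_zsmul Real.two_pi_pos (-Real.pi)
      (2 * Real.pi * regVal x / 2 ^ m)
    rw [zsmul_eq_mul] at h
    have h' : θ - 2 * Real.pi * regVal x / 2 ^ m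
        = -ψ - (toIocDiv Real.two_pi_pos (-Real.pi) (2 * Real.pi * regVal x / 2 ^ m) : ℤ)
          * (2 * Real.pi) := by
      rw [hψ, phaseEstimate]
      linarith
    rw [h', Real.cos_sub_int_mul_two_pi, Real.cos_neg, Real.cos_abs]
  have habs : |ψ| ≤ Real.pi + 1 := by
    rw [abs_le]
    constructor <;> linarith [hmem.1, hmem.2, hθ.1, hθ.2]
  have hle : Real.cos |ψ| ≤ Real.cos ε := by
    rcases le_total |ψ| Real.pi with h | h
    · exact Real.cos_le_cos_of_nonneg_of_le_pi hε.le h hx.le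
    · rw [← Real.cos_two_pi_sub]
      exact Real.cos_le_cos_of_nonneg_of_le_pi hε.le (by linarith) (by linarith)
  -- Chosen so that `2 - 2 cos ε ≥ (ε / 2)²`; the constant comes from `cos ε ≤ 1 - 2 ε² / π²` and `π
  -- ≤ 4`.
  have hce : Real.cos ε ≤ 1 - ε ^ 2 / 8 := by
    refine (Real.cos_le_one_sub_mul_cos_sq (x := ε) ?_).trans ?_
    · rw [abs_of_pos hε]; linarith
    · have : 1 / 8 ≤ 2 / Real.pi ^ 2 := by
        rw [div_le_div_iff₀ (by norm_num) (by positivity)]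
        nlinarith
      nlinarith [sq_nonneg ε]
  refine (pow_le_pow_iff_left₀ (by positivity) (norm_nonneg _) two_ne_zero).mp ?_
  have hn : ‖1 - outcomePhase m θ (regVal x)‖ ^ 2 = 2 - 2 * Real.cos |ψ| := by
    rw [← Complex.normSq_eq_norm_sq, Complex.normSq_sub, Complex.normSq_eq_norm_sq,
      Complex.normSq_eq_norm_sq, norm_outcomePhase, ← hcos]
    simp only [outcomePhase, one_mul, Complex.conj_re, Complex.exp_ofReal_mul_I_re, norm_one]
    norm_num
  rw [hn]
  nlinarith [sq_nonneg ε]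

end tail

/-! ### Transfer to outcome probabilities and success probability -/

section main
variable {d : Type} [Fintype d] [DecidableEq d] {m : ℕ}

lemma sum_outcomeProb_le_trace {d : Type} [Fintype d] {τ : Matrix (Reg m × d) (Reg m × d) ℂ} (hτ : τ.PosSemidef)
    (s : Finset (Reg m)) : ∑ x ∈ s, outcomeProb τ x ≤ τ.trace.re := by
  have h : ∀ x, 0 ≤ outcomeProb τ x := fun x => Finset.sum_nonneg fun a _ =>
    (Complex.nonneg_iff.mp (hτ.diag_nonneg : 0 ≤ τ (x, a) (x, a))).1
  refine (Finset.sum_le_sum_of_subset_of_nonneg (Finset.subset_univ s) fun x _ _ => h x).trans ?_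
  rw [trace, Complex.re_sum, Fintype.sum_prod_type]
  rfl

lemma sum_outcomeProb_nonneg {d : Type} [Fintype d] {τ : Matrix (Reg m × d) (Reg m × d) ℂ} (hτ : τ.PosSemidef)
    (s : Finset (Reg m)) : 0 ≤ ∑ x ∈ s, outcomeProb τ x :=
  Finset.sum_nonneg fun x _ => Finset.sum_nonneg fun a _ =>
    (Complex.nonneg_iff.mp (hτ.diag_nonneg : 0 ≤ τ (x, a) (x, a))).1

lemma outcomeProb_sub {d : Type} [Fintype d] (τ τ' : Matrix (Reg m × d) (Reg m × d) ℂ) (x : Reg m) :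
    outcomeProb (τ - τ') x = outcomeProb τ x - outcomeProb τ' x := by
  simp [outcomeProb, Finset.sum_sub_distrib]

/-- Close operations have close outcome probabilities. -/
lemma Close.sum_outcomeProb_le {a d : Type} [Fintype a] [Fintype d] {Φ Ψ : SuperOp a (Reg m × d)} {δ : ℝ}
    (h : Close Φ Ψ δ) {σ : Matrix a a ℂ} (hσ : IsDensity σ) (s : Finset (Reg m)) :
    ∑ x ∈ s, outcomeProb (Ψ σ) x - δ ≤ ∑ x ∈ s, outcomeProb (Φ σ) x := by
  obtain ⟨P, Q, hP, hQ, h, ht⟩ := h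
  have h1 : Φ σ - Ψ σ = P σ - Q σ := LinearMap.congr_fun h σ
  have h2 := ht σ hσ.1
  rw [LinearMap.add_apply, trace_add, Complex.add_re, hσ.2, Complex.one_re, mul_one] at h2
  have h3 : ∑ x ∈ s, outcomeProb (Φ σ) x - ∑ x ∈ s, outcomeProb (Ψ σ) x
      = ∑ x ∈ s, outcomeProb (P σ) x - ∑ x ∈ s, outcomeProb (Q σ) x := by
    simp only [← Finset.sum_sub_distrib, ← outcomeProb_sub, h1]
  -- The positive part can only raise the probability; the negative part lowers it by at most its
  -- trace.
  have h4 := sum_outcomeProb_nonneg (hP.posSemidef hσ.1) s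
  have h5 := sum_outcomeProb_le_trace (hQ.posSemidef hσ.1) s
  have h6 := trace_re_nonneg (hP.posSemidef hσ.1)
  linarith

lemma isDensity_vecMulVec {d : Type} [Fintype d] {v : d → ℂ} (hv : star v ⬝ᵥ v = 1) :
    IsDensity (vecMulVec v (star v)) :=
  ⟨posSemidef_vecMulVec_self_star v, by rw [trace_vecMulVec, dotProduct_comm, hv]⟩

/-- Exact phase estimation reports an accurate phase, except with small probability. -/
lemma le_sum_outcomeProb_kitaev {U : Matrix d d ℂ} {v : d → ℂ} {θ ε : ℝ}
    (hv : star v ⬝ᵥ v = 1) (h : U *ᵥ v = Complex.exp (θ * Complex.I) • v)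
    (hθ : θ ∈ Set.Icc (-1) 0) (hε : 0 < ε) (hε1 : ε < 1) (hm : 9 / ε ≤ 2 ^ m) :
    1 - 36 / ε / 2 ^ m ≤ ∑ x : Reg m with |phaseEstimate x - θ| ≤ ε,
      outcomeProb (kitaev m U (vecMulVec v (star v))) x := by
  have h1 := sum_outcome_eq_one m θ
  rw [← Finset.sum_filter_add_sum_filter_not _ fun x : Reg m => |phaseEstimate x - θ| ≤ ε] at h1
  -- The averaging length must satisfy `N · (ε / 2) ≥ 4`; rounding `8 / ε` up costs at most `1 ≤ 1 /
  -- ε`.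
  have hN : (⌈8 / ε⌉₊ : ℝ) ≤ 9 / ε := by
    have := (Nat.ceil_lt_add_one (by positivity : 0 ≤ 8 / ε)).le
    have h1ε : 1 ≤ 1 / ε := by rw [le_div_iff₀ hε]; linarith
    calc (⌈8 / ε⌉₊ : ℝ) ≤ 8 / ε + 1 := this
      _ ≤ 8 / ε + 1 / ε := by gcongr
      _ = 9 / ε := by ring
  have h2 := sum_outcome_tail_le m θ (half_pos hε) (N := ⌈8 / ε⌉₊)
    (by
      calc (4 : ℝ) = 8 / ε * (ε / 2) := by field_simp; norm_num
        _ ≤ ⌈8 / ε⌉₊ * (ε / 2) := by gcongr; exact Nat.le_ceil _)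
    (by exact_mod_cast hN.trans hm)
    (Finset.univ.filter fun x : Reg m => ¬ |phaseEstimate x - θ| ≤ ε)
    fun x hx => le_norm_one_sub_outcomePhase hθ hε hε1.le
      (not_le.mp (Finset.mem_filter.mp hx).2)
  have h3 : 4 * (⌈8 / ε⌉₊ : ℝ) / 2 ^ m ≤ 36 / ε / 2 ^ m := by
    gcongr
    calc 4 * (⌈8 / ε⌉₊ : ℝ) ≤ 4 * (9 / ε) := by gcongr
      _ = 36 / ε := by ring
  simp only [outcomeProb_kitaev hv h]
  linarith

lemma phaseEstimate_zero (x : Reg 0) : phaseEstimate x = 0 := by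
  have : regVal x = 0 := by simp [regVal]
  rw [phaseEstimate, this, Nat.cast_zero, mul_zero, zero_div, toIocMod_eq_self]
  constructor <;> linarith [Real.pi_pos]

/-- With no register qubits the schedule is empty and the gate is never used. -/
lemma phaseEstimation_zero (G G' : SuperOp (Fin 2 × d) (Fin 2 × d)) :
    phaseEstimation 0 G = phaseEstimation 0 G' := rfl

end main

end SamplePhaseEstimation

end

/-! ### Choice of parameters -/

theorem mainTheorem12 (η : ℝ) (hη0 : 0 < η) (hη1 : η < 1) :
    ∃ C : ℝ, 0 < C ∧ ∀ ε : ℝ, 0 < ε →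
      ∃ m r : ℕ, (samplesUsed m r : ℝ) ≤ C / ε ^ 2 ∧
        ∀ D : ℕ, ∃ G : SuperOp ((Fin 2 × Fin D) × (Fin r → Fin D)) (Fin 2 × Fin D),
          IsChannel G ∧
          ∀ ρ : Matrix (Fin D) (Fin D) ℂ, IsDensity ρ →
            DiamondDistLE (phaseEstimation m (withCopies r G ρ))
              (kitaev m (NormedSpace.exp ((-Complex.I) • ρ))) η ∧
            ∀ (θ : ℝ) (v : Fin D → ℂ), θ ∈ Set.Ioc (-Real.pi) Real.pi → star v ⬝ᵥ v = 1 →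
              NormedSpace.exp ((-Complex.I) • ρ) *ᵥ v = Complex.exp (θ * Complex.I) • v →
              1 - η ≤ ∑ x : Reg m with |phaseEstimate x - θ| ≤ ε,
                outcomeProb (phaseEstimation m (withCopies r G ρ) (Matrix.vecMulVec v (star v)))
                  x := by
  -- From `(2^m - 1) r ≤ 9 (2^m - 1)² / η` and `2^m ≤ 144 / (ε η)`.
  refine ⟨9 * 144 ^ 2 / η ^ 3, by positivity, fun ε hε => ?_⟩
  rcases le_or_gt 1 ε with hε1 | hε1
  -- For `ε ≥ 1` no copies are needed: the empty register reports phase `0`, and the true phase lies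
  -- in `[-1, 0]`.
  · refine ⟨0, 0, ?_, fun D => ⟨lmr (Fin D) 0 0, isChannel_lmr 0 0, fun ρ hρ => ⟨?_, ?_⟩⟩⟩
    · simp only [samplesUsed, mul_zero, Nat.cast_zero]
      positivity
    · intro k σ hσ
      exact ((Close.refl _).diamondDistLE k σ hσ).trans (by linarith)
    · intro θ v hθ hv h
      have hmem := phase_mem_Icc hρ hθ hv h
      have hall : (Finset.univ.filter fun x : Reg 0 => |phaseEstimate x - θ| ≤ ε)
          = Finset.univ := by
        refine Finset.filter_true_of_mem fun x _ => ?_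
        rw [phaseEstimate_zero, zero_sub, abs_neg, abs_of_nonpos hmem.2]
        linarith [hmem.1]
      have hsum : ∑ x : Reg 0, outcomeProb (phaseEstimation 0 (withCopies 0 (lmr (Fin D) 0 0) ρ)
          (Matrix.vecMulVec v (star v))) x = 1 := by
        rw [phaseEstimation_zero _ (conjBy (controlled (NormedSpace.exp ((-Complex.I) • ρ)))),
          ← sum_outcome_eq_one 0 θ]
        exact Finset.sum_congr rfl fun x _ => outcomeProb_kitaev hv h x
      rw [hall, hsum]
      linarith
  -- `2^m` is taken as the power of two in `(72 / (ε η), 144 / (ε η)]`, which makes the tail `36 /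
  -- (ε 2^m)` at most `η / 2`.
  · have hX : 1 ≤ 72 / (ε * η) := by
      rw [le_div_iff₀ (by positivity)]
      nlinarith
    obtain ⟨n, hn1, hn2⟩ := exists_nat_pow_near hX one_lt_two
    set m := n + 1 with hm
    have hM : (2 : ℝ) ^ m ≤ 144 / (ε * η) := by
      calc (2 : ℝ) ^ m = 2 ^ n * 2 := pow_succ _ _
        _ ≤ 72 / (ε * η) * 2 := by gcongr
        _ = _ := by ring
    set N : ℕ := 2 ^ m - 1 with hN
    have hN1 : 1 ≤ N := by
      have : 2 ^ 1 ≤ 2 ^ m := Nat.pow_le_pow_right (by norm_num) (by omega)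
      omega
    have hN1' : (1 : ℝ) ≤ N := by exact_mod_cast hN1
    have hNM : (N : ℝ) ≤ 144 / (ε * η) := by
      refine le_trans ?_ hM
      have : N ≤ 2 ^ m := Nat.sub_le _ _
      exact_mod_cast this
    -- Makes the accumulated gate error `4 N / r` at most `η / 2`, the other half of the failure
    -- budget.
    set r : ℕ := ⌈8 * N / η⌉₊ with hr
    have hr8 : 8 * N / η ≤ (r : ℝ) := Nat.le_ceil _
    have hr0 : (0 : ℝ) < r := lt_of_lt_of_le (by positivity) hr8
    have hr9 : (r : ℝ) ≤ 9 * N / η := by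
      have h1 := (Nat.ceil_lt_add_one (by positivity : 0 ≤ 8 * N / η)).le
      have h2 : 1 ≤ N / η := by rw [le_div_iff₀ hη0]; linarith
      calc (r : ℝ) ≤ 8 * N / η + 1 := h1
        _ ≤ 8 * N / η + N / η := by gcongr
        _ = _ := by ring
    refine ⟨m, r, ?_, fun D => ⟨lmr (Fin D) (1 / r) r, isChannel_lmr _ _, fun ρ hρ => ?_⟩⟩
    · rw [samplesUsed, length_controlSchedule, ← hN, Nat.cast_mul]
      calc (N : ℝ) * r ≤ N * (9 * N / η) := by gcongr
        _ = 9 / η * (N : ℝ) ^ 2 := by ring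
        _ ≤ 9 / η * (144 / (ε * η)) ^ 2 := by gcongr
        _ = 9 * 144 ^ 2 / η ^ 3 / ε ^ 2 := by field_simp
    · have hclose : Close (phaseEstimation m (withCopies r (lmr (Fin D) (1 / r) r) ρ))
          (kitaev m (NormedSpace.exp ((-Complex.I) • ρ))) (η / 2) := by
        refine (Close.phaseEstimation m (by positivity)
          (close_withCopies_lmr hρ (by exact_mod_cast hr0)) (IsCP.withCopies_lmr hρ _ _)
          (TraceLE.withCopies_lmr hρ _ _) (IsCP.conjBy _)
          (TraceLE.conjBy_controlled_exp hρ)).mono ?_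
        rw [← hN, mul_div_assoc', div_le_iff₀ hr0]
        rw [div_le_iff₀ hη0] at hr8
        linarith
      refine ⟨fun k σ hσ => (hclose.diamondDistLE k σ hσ).trans (by linarith), ?_⟩
      intro θ v hθ hv h
      have hmem := phase_mem_Icc hρ hθ hv h
      have h9 : 9 / ε ≤ 2 ^ m := by
        refine le_trans ?_ hn2.le
        rw [div_le_div_iff₀ hε (by positivity)]
        nlinarith
      have h1 := le_sum_outcomeProb_kitaev hv h hmem hε hε1 h9
      have h2 := hclose.sum_outcomeProb_le (isDensity_vecMulVec hv)
        (Finset.univ.filter fun x : Reg m => |phaseEstimate x - θ| ≤ ε)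
      have h3 : 36 / ε / 2 ^ m ≤ η / 2 := by
        rw [div_le_iff₀ (by positivity)]
        calc 36 / ε = η / 2 * (72 / (ε * η)) := by field_simp; norm_num
          _ ≤ η / 2 * 2 ^ m := by gcongr
      linarith
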